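/- For every $\varepsilon>0$ there exists $d_0\in\mathbb{N}$ such that the following holds for all integers $d\ge d_0$. Let $G$ be a finite simple $d$-regular graph with $n$ vertices. Then all but at most $\varepsilon n$ of the vertices of $G$ can be partitioned into at most $n/(d+1)$ paths of $G$; that is, there are at most $n/(d+1)$ pairwise vertex-disjoint paths in $G$ (a single vertex counting as a path) which together contain all but at most $\varepsilon n$ of the vertices of $G$. -/

import Mathlib

/-- The family `p` consists of paths of `G` (one-vertex paths allowed) that are pairwise
vertex-disjoint and whose vertex sets have union `S`: it partitions `S` into `k` paths. -/
def IsPathPartition {V : Type*} (G : SimpleGraph V) (S : Set V) {k : ℕ} {a b : Fin k → V}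
    (p : ∀ i, G.Walk (a i) (b i)) : Prop :=
  (∀ i, (p i).IsPath) ∧
  (∀ i j, i ≠ j → ∀ v, v ∈ (p i).support → v ∉ (p j).support) ∧
  (∀ v, v ∈ S ↔ ∃ i, v ∈ (p i).support)

/-!
Why almost all vertices of a `d`-regular graph on `n` vertices lie on `n / (d + 1)` disjoint paths.

*Merging.*  Suppose that the paths of a system avoid a reserve `R` in which almost every vertex has
`η d` neighbours, where `|R|` is about `η n`.  If two paths start at vertices with a common unused
neighbour in `R`, they can be joined through it.  When no two can be joined, the neighbourhoods of
the starting vertices in `R` are disjoint, so there are at most about `|R| / (η d) = n / d` paths.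
Reserve vertices that have been used spoil this only at the few vertices having many of them as
neighbours, and such vertices are avoided by trimming short initial segments of the paths
(`IsPathSystem.exists_merge`, `IsPathSystem.exists_merged`).  With `P n` paths at the beginning, the
error in the number of paths is of order `P ^ 2 n`, so that a few rounds with fresh reserves reduce
any system of `d ^ (-c) n` paths to about `n / d` paths (`IsEquitable.exists_round`).

*The beginning.*  Colour the vertices with about `d ^ (1 / 7)` colours.  For an average colouring,
by Chebyshev's inequality, almost all vertices have nearly the same number of neighbours in every
colour (`exists_isEquitable`).  Some colours are set aside for the reserves.  Between the classes of
the others, taken in some order, Hall's theorem gives nearly perfect matchings, whose union is the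
first path system (`IsEquitable.exists_isPathSystem`).

*From `n / d` to `n / (d + 1)`.*  If `n / d` is large, dropping the shortest paths suffices.
Otherwise at most one path too many is left, and `n / d` is bounded.  Count induced cherries, that
is, induced paths on three vertices.  If there are many, then a reserve of three colour groups
contains many of them, and some two paths can be joined by a longer path inside that reserve: if
not, the reserve would fall into parts that are almost cliques, with few induced cherries
(`IsPathSystem.exists_link_or_card_inducedCherries_le`).  If there are few, then the whole graph is
nearly a disjoint union of at most `⌊n / (d + 1)⌋ + 1` almost complete sets (`exists_cores`), each of
which is nearly covered by one path.  If that bound is attained, then, because every component has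
at least `d + 1` vertices, two of these sets lie in the same component, and a shortest connection
between two of them joins two of the paths (`exists_isPathSystem_card_lt`).
-/

/-! ### Systems of disjoint paths -/

section PathSystem

variable {V : Type*}

/-- A finite family of pairwise vertex-disjoint paths of `G`.  A path is encoded by the list of its
vertices in order, so it comes with a direction that carries no information. -/
structure IsPathSystem (G : SimpleGraph V) (𝓛 : Finset (List V)) : Prop where
  ne_nil : ∀ l ∈ 𝓛, l ≠ []
  nodup : ∀ l ∈ 𝓛, l.Nodup
  chain : ∀ l ∈ 𝓛, l.IsChain G.Adj
  disjoint : ∀ l ∈ 𝓛, ∀ l' ∈ 𝓛, l ≠ l' → l.Disjoint l'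

variable {G : SimpleGraph V} {𝓛 : Finset (List V)}

theorem isPathSystem_empty (G : SimpleGraph V) : IsPathSystem G ∅ :=
  ⟨by simp, by simp, by simp, by simp⟩

theorem IsPathSystem.mono {𝓜 : Finset (List V)} (h : IsPathSystem G 𝓛) (hs : 𝓜 ⊆ 𝓛) :
    IsPathSystem G 𝓜 :=
  ⟨fun l hl => h.ne_nil l (hs hl), fun l hl => h.nodup l (hs hl), fun l hl => h.chain l (hs hl),
    fun l hl l' hl' => h.disjoint l (hs hl) l' (hs hl')⟩

variable [DecidableEq V]

/-- The set of vertices lying on the paths of a system. -/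
def covered (𝓛 : Finset (List V)) : Finset V := 𝓛.biUnion List.toFinset

theorem mem_covered {𝓛 : Finset (List V)} {v : V} : v ∈ covered 𝓛 ↔ ∃ l ∈ 𝓛, v ∈ l := by
  simp [covered]

theorem covered_mono {𝓛 𝓜 : Finset (List V)} (h : 𝓛 ⊆ 𝓜) : covered 𝓛 ⊆ covered 𝓜 :=
  Finset.biUnion_subset_biUnion_of_subset_left _ h

theorem covered_insert (l : List V) (𝓛 : Finset (List V)) :
    covered (insert l 𝓛) = l.toFinset ∪ covered 𝓛 := by
  simp [covered, Finset.biUnion_insert]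

theorem IsPathSystem.card_covered (h : IsPathSystem G 𝓛) :
    (covered 𝓛).card = ∑ l ∈ 𝓛, l.length := by
  rw [covered, Finset.card_biUnion]
  · exact Finset.sum_congr rfl fun l hl => List.toFinset_card_of_nodup (h.nodup l hl)
  · intro l hl l' hl' hne
    exact List.disjoint_toFinset_iff_disjoint.2 (h.disjoint l hl l' hl' hne)

theorem IsPathSystem.card_covered_erase (h : IsPathSystem G 𝓛) {l : List V} (hl : l ∈ 𝓛) :
    (covered 𝓛).card = (covered (𝓛.erase l)).card + l.length := by
  rw [h.card_covered, (h.mono (Finset.erase_subset l 𝓛)).card_covered,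
    Finset.sum_erase_add _ _ hl]

theorem IsPathSystem.disjoint_covered_erase (h : IsPathSystem G 𝓛) {l : List V} (hl : l ∈ 𝓛) :
    ∀ v ∈ l, v ∉ covered (𝓛.erase l) := by
  intro v hv hv'
  obtain ⟨l', hl', hvl'⟩ := mem_covered.1 hv'
  rw [Finset.mem_erase] at hl'
  exact h.disjoint l hl l' hl'.2 (Ne.symm hl'.1) hv hvl'

theorem not_mem_of_disjoint_covered {l : List V} (hne : l ≠ [])
    (hd : ∀ v ∈ l, v ∉ covered 𝓛) : l ∉ 𝓛 := by
  intro hl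
  obtain ⟨v, hv⟩ := List.exists_mem_of_ne_nil l hne
  exact hd v hv (mem_covered.2 ⟨l, hl, hv⟩)

theorem IsPathSystem.insert (h : IsPathSystem G 𝓛) {l : List V} (hne : l ≠ []) (hnd : l.Nodup)
    (hc : l.IsChain G.Adj) (hd : ∀ v ∈ l, v ∉ covered 𝓛) : IsPathSystem G (insert l 𝓛) := by
  have key : ∀ l' ∈ 𝓛, l.Disjoint l' := fun l' hl' v hv hv' =>
    hd v hv (mem_covered.2 ⟨l', hl', hv'⟩)
  refine ⟨?_, ?_, ?_, ?_⟩
  · simpa [hne] using h.ne_nil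
  · simpa [hnd] using h.nodup
  · simpa [hc] using h.chain
  · intro a ha b hb hab
    rw [Finset.mem_insert] at ha hb
    rcases ha with rfl | ha <;> rcases hb with rfl | hb
    · exact absurd rfl hab
    · exact key b hb
    · exact (key a ha).symm
    · exact h.disjoint a ha b hb hab

/-- Two paths of a system are joined into one: the first is cut at its vertex `x`, the second at
its vertex `y`, the initial pieces `l₁`, `m₁` are thrown away, and a connecting path `w` outside the
system is inserted between `x` and `y`. -/
theorem IsPathSystem.join (h : IsPathSystem G 𝓛) {l₁ l₂ m₁ m₂ w : List V} {x y : V}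
    (hl : l₁ ++ x :: l₂ ∈ 𝓛) (hm : m₁ ++ y :: m₂ ∈ 𝓛) (hne : l₁ ++ x :: l₂ ≠ m₁ ++ y :: m₂)
    (hw : w.Nodup) (hwc : (x :: (w ++ [y])).IsChain G.Adj) (hwd : ∀ v ∈ w, v ∉ covered 𝓛) :
    ∃ 𝓜, IsPathSystem G 𝓜 ∧ 𝓜.card + 1 = 𝓛.card ∧ covered 𝓜 ⊆ covered 𝓛 ∪ w.toFinset ∧
      (covered 𝓛).card ≤ (covered 𝓜).card + (l₁.length + m₁.length) := by
  set l := l₁ ++ x :: l₂ with hldef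
  set m := m₁ ++ y :: m₂ with hmdef
  set 𝓝 := (𝓛.erase l).erase m with h𝓝
  have hm' : m ∈ 𝓛.erase l := Finset.mem_erase.2 ⟨Ne.symm hne, hm⟩
  have hE := h.mono (Finset.erase_subset l 𝓛)
  have hN : IsPathSystem G 𝓝 := hE.mono (Finset.erase_subset m _)
  have hNsub : covered 𝓝 ⊆ covered 𝓛 :=
    covered_mono ((Finset.erase_subset _ _).trans (Finset.erase_subset _ _))
  set new := (x :: l₂).reverse ++ (w ++ y :: m₂) with hnew
  have hldis : ∀ v ∈ l, v ∉ covered 𝓝 := fun v hv hv' =>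
    h.disjoint_covered_erase hl v hv (covered_mono (Finset.erase_subset m _) hv')
  have hmdis : ∀ v ∈ m, v ∉ covered 𝓝 := hE.disjoint_covered_erase hm'
  have hlnd := h.nodup l hl
  have hmnd := h.nodup m hm
  have hlm : l.Disjoint m := h.disjoint l hl m hm hne
  have hwl : ∀ v ∈ w, v ∉ l := fun v hv hv' => hwd v hv (mem_covered.2 ⟨l, hl, hv'⟩)
  have hwm : ∀ v ∈ w, v ∉ m := fun v hv hv' => hwd v hv (mem_covered.2 ⟨m, hm, hv'⟩)
  have hxl : ∀ v ∈ x :: l₂, v ∈ l := fun v hv => by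
    rw [hldef]; exact List.mem_append_right _ hv
  have hym : ∀ v ∈ y :: m₂, v ∈ m := fun v hv => by
    rw [hmdef]; exact List.mem_append_right _ hv
  have hnd : new.Nodup := by
    rw [hnew, List.nodup_append', List.nodup_append', List.nodup_reverse]
    refine ⟨(List.nodup_append'.1 hlnd).2.1, ⟨hw, (List.nodup_append'.1 hmnd).2.1, ?_⟩, ?_⟩
    · intro v hv hv'
      exact hwm v hv (hym v hv')
    · intro v hv hv'
      rw [List.mem_reverse] at hv
      rcases List.mem_append.1 hv' with hv' | hv'
      · exact hwl v hv' (hxl v hv)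
      · exact hlm (hxl v hv) (hym v hv')
  have hch : new.IsChain G.Adj := by
    have h1 : (x :: l₂).reverse.IsChain G.Adj := by
      rw [List.isChain_reverse]
      refine ((h.chain l hl).right_of_append).imp ?_
      intro a b hab
      exact hab.symm
    have h2 : (y :: m₂).IsChain G.Adj := (h.chain m hm).right_of_append
    have e1 : new = l₂.reverse ++ ([x] ++ (w ++ y :: m₂)) := by simp [hnew]
    have h3 : ((x :: w) ++ y :: m₂).IsChain G.Adj := by
      rw [List.isChain_split]
      exact ⟨by simpa using hwc, h2⟩
    rw [e1]
    have e2 : l₂.reverse ++ ([x] ++ (w ++ y :: m₂)) = l₂.reverse ++ x :: (w ++ y :: m₂) := by simp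
    rw [e2, List.isChain_split]
    exact ⟨by simpa using h1, by simpa using h3⟩
  have hdis : ∀ v ∈ new, v ∉ covered 𝓝 := by
    intro v hv
    rw [hnew] at hv
    rcases List.mem_append.1 hv with hv | hv
    · exact hldis v (hxl v (List.mem_reverse.1 hv))
    · rcases List.mem_append.1 hv with hv | hv
      · exact fun hv' => hwd v hv (hNsub hv')
      · exact hmdis v (hym v hv)
  have hnn : new ≠ [] := by simp [hnew]
  have hnot : new ∉ 𝓝 := not_mem_of_disjoint_covered hnn hdis
  have hM := hN.insert hnn hnd hch hdis
  refine ⟨Insert.insert new 𝓝, hM, ?_, ?_, ?_⟩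
  · have h1 := Finset.card_erase_add_one hl
    have h2 := Finset.card_erase_add_one hm'
    rw [← h𝓝] at h2
    rw [Finset.card_insert_of_notMem hnot]
    omega
  · rw [covered_insert]
    intro v hv
    rw [Finset.mem_union] at hv ⊢
    rcases hv with hv | hv
    · rw [List.mem_toFinset, hnew] at hv
      rcases List.mem_append.1 hv with hv | hv
      · exact Or.inl (mem_covered.2 ⟨l, hl, hxl v (List.mem_reverse.1 hv)⟩)
      · rcases List.mem_append.1 hv with hv | hv
        · exact Or.inr (List.mem_toFinset.2 hv)
        · exact Or.inl (mem_covered.2 ⟨m, hm, hym v hv⟩)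
    · exact Or.inl (hNsub hv)
  · have h1 := h.card_covered_erase hl
    have h2 := hE.card_covered_erase hm'
    have h3 := hM.card_covered
    rw [Finset.sum_insert hnot, ← hN.card_covered] at h3
    have h4 : l.length = l₁.length + (l₂.length + 1) := by simp [hldef]
    have h5 : m.length = m₁.length + (m₂.length + 1) := by simp [hmdef]
    have h6 : new.length = l₂.length + 1 + (w.length + (m₂.length + 1)) := by
      simp [hnew]; omega
    rw [← h𝓝] at h2
    omega

/-- Keeping the `k` heaviest members of a family keeps at least the average weight. -/
theorem exists_subset_card_eq_average {α : Type*} [DecidableEq α] (s : Finset α) (f : α → ℕ)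
    (k : ℕ) (hk : k ≤ s.card) :
    ∃ t ⊆ s, t.card = k ∧ (∑ a ∈ s, f a) * k ≤ (∑ a ∈ t, f a) * s.card := by
  induction hn : s.card - k generalizing s with
  | zero => exact ⟨s, subset_rfl, by omega, by rw [show k = s.card by omega]⟩
  | succ r ih =>
    have hs : s.Nonempty := Finset.card_pos.1 (by omega)
    obtain ⟨a, ha, hmin⟩ := Finset.exists_min_image s f hs
    have hc := Finset.card_erase_add_one ha
    obtain ⟨t, hts, htc, ht⟩ := ih (s.erase a) (by omega) (by omega)
    refine ⟨t, hts.trans (Finset.erase_subset _ _), htc, ?_⟩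
    have hsum := Finset.add_sum_erase s f ha
    have havg : s.card * f a ≤ ∑ b ∈ s, f b := by
      rw [← smul_eq_mul]; exact Finset.card_nsmul_le_sum s f _ hmin
    rcases Nat.eq_zero_or_pos (s.erase a).card with h0 | hpos
    · have : k = 0 := by omega
      subst this; simp
    · -- with `S` the total and `c = |s|`: `(c - 1) S ≤ c (S - f a)`, as `c f a ≤ S`
      set S := ∑ b ∈ s, f b
      set S' := ∑ b ∈ s.erase a, f b
      set c := (s.erase a).card
      rw [← hc] at havg ⊢
      have h1 : c * S ≤ (c + 1) * S' := by nlinarith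
      have h2 : c * (S * k) ≤ c * ((∑ b ∈ t, f b) * (c + 1)) := by
        calc c * (S * k) = (c * S) * k := by ring
          _ ≤ ((c + 1) * S') * k := Nat.mul_le_mul_right _ h1
          _ = (c + 1) * (S' * k) := by ring
          _ ≤ (c + 1) * ((∑ b ∈ t, f b) * c) := Nat.mul_le_mul_left _ ht
          _ = _ := by ring
      exact Nat.le_of_mul_le_mul_left h2 hpos

theorem IsPathSystem.exists_card_eq (h : IsPathSystem G 𝓛) (k : ℕ) (hk : k ≤ 𝓛.card) :
    ∃ 𝓜, IsPathSystem G 𝓜 ∧ 𝓜.card = k ∧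
      (covered 𝓛).card * k ≤ (covered 𝓜).card * 𝓛.card := by
  obtain ⟨𝓜, hs, hc, hle⟩ := exists_subset_card_eq_average 𝓛 List.length k hk
  exact ⟨𝓜, h.mono hs, hc, by rwa [h.card_covered, (h.mono hs).card_covered]⟩

/-- A path system is a partition of the set it covers, in the sense of walks. -/
theorem IsPathSystem.exists_isPathPartition (h : IsPathSystem G 𝓛) :
    ∃ (a b : Fin 𝓛.card → V) (p : ∀ i, G.Walk (a i) (b i)),
      IsPathPartition G (covered 𝓛 : Set V) p := by
  set e := 𝓛.equivFin.symm
  refine ⟨fun i => (e i).1.head (h.ne_nil _ (e i).2), fun i => (e i).1.getLast (h.ne_nil _ (e i).2),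
    fun i => SimpleGraph.Walk.ofSupport (e i).1 (h.ne_nil _ (e i).2) (h.chain _ (e i).2),
    ?_, ?_, ?_⟩
  · intro i
    rw [SimpleGraph.Walk.isPath_def, SimpleGraph.Walk.support_ofSupport]
    exact h.nodup _ (e i).2
  · intro i j hij v hv hv'
    rw [SimpleGraph.Walk.support_ofSupport] at hv hv'
    refine h.disjoint _ (e i).2 _ (e j).2 (fun heq => hij ?_) hv hv'
    exact e.injective (Subtype.ext heq)
  · intro v
    simp only [SimpleGraph.Walk.support_ofSupport, Finset.mem_coe, mem_covered]
    constructor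
    · rintro ⟨l, hl, hv⟩
      exact ⟨e.symm ⟨l, hl⟩, by simpa using hv⟩
    · rintro ⟨i, hv⟩
      exact ⟨_, (e i).2, hv⟩

theorem IsPathSystem.card_mul_le_of_take_subset (h : IsPathSystem G 𝓛) {s : ℕ} {B : Finset V}
    (hs : ∀ l ∈ 𝓛, s ≤ l.length) (hB : ∀ l ∈ 𝓛, ∀ v ∈ l.take s, v ∈ B) :
    𝓛.card * s ≤ B.card := by
  have h1 : (𝓛.biUnion fun l => (l.take s).toFinset).card = 𝓛.card * s := by
    rw [Finset.card_biUnion, Finset.sum_const_nat]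
    · intro l hl
      rw [List.toFinset_card_of_nodup ((h.nodup l hl).sublist (List.take_sublist s l)),
        List.length_take, min_eq_left (hs l hl)]
    · intro l hl m hm hne
      refine List.disjoint_toFinset_iff_disjoint.2 fun v hv hv' => ?_
      exact h.disjoint l hl m hm hne (List.mem_of_mem_take hv) (List.mem_of_mem_take hv')
  rw [← h1]
  refine Finset.card_le_card fun v hv => ?_
  obtain ⟨l, hl, hv⟩ := Finset.mem_biUnion.1 hv
  exact hB l hl v (List.mem_toFinset.1 hv)

theorem List.exists_eq_append_cons_of_mem_take {α : Type*} {l : List α} {s : ℕ} {x : α}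
    (hx : x ∈ l.take s) : ∃ l₁ l₂, l = l₁ ++ x :: l₂ ∧ l₁.length ≤ s := by
  obtain ⟨a, b, hab⟩ := List.append_of_mem hx
  refine ⟨a, b ++ l.drop s, ?_, ?_⟩
  · conv_lhs => rw [← List.take_append_drop s l, hab]
    simp
  · have : (a ++ x :: b).length ≤ s := by rw [← hab]; simp
    simp at this; omega

end PathSystem

/-! ### Joining paths through a reserve -/

section Merge

variable {V : Type*} [Fintype V] [DecidableEq V] {G : SimpleGraph V} [DecidableRel G.Adj]
  {𝓛 : Finset (List V)}

theorem sum_card_neighborFinset_inter_comm (G : SimpleGraph V) [DecidableRel G.Adj]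
    (S T : Finset V) :
    ∑ v ∈ S, (G.neighborFinset v ∩ T).card = ∑ u ∈ T, (G.neighborFinset u ∩ S).card := by
  have h := Finset.sum_card_bipartiteAbove_eq_sum_card_bipartiteBelow (s := S) (t := T) G.Adj
  have h1 : ∀ v, G.neighborFinset v ∩ T = Finset.bipartiteAbove G.Adj T v := fun v => by
    ext w; simp [Finset.bipartiteAbove, and_comm]
  have h2 : ∀ v, G.neighborFinset v ∩ S = Finset.bipartiteBelow G.Adj S v := fun v => by
    ext w; simp [Finset.bipartiteBelow, and_comm, G.adj_comm]
  simpa only [h1, h2] using h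

/-- In a graph of maximum degree at most `d`, few vertices have many neighbours in a small set. -/
theorem card_filter_lt_card_inter_mul_le {d : ℕ} (hd : ∀ v, G.degree v ≤ d) (U : Finset V)
    (τ : ℝ) :
    ((Finset.univ.filter fun v => τ < ((G.neighborFinset v ∩ U).card : ℝ)).card : ℝ) * τ
      ≤ d * U.card := by
  set S := Finset.univ.filter fun v => τ < ((G.neighborFinset v ∩ U).card : ℝ)
  have h1 : (S.card : ℝ) * τ ≤ ∑ v ∈ S, ((G.neighborFinset v ∩ U).card : ℝ) := by
    rw [← nsmul_eq_mul]
    exact Finset.card_nsmul_le_sum S _ _ fun v hv => (Finset.mem_filter.1 hv).2.le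
  have h2 : ∑ v ∈ S, (G.neighborFinset v ∩ U).card ≤ U.card * d := by
    rw [sum_card_neighborFinset_inter_comm, ← smul_eq_mul]
    refine Finset.sum_le_card_nsmul U _ d fun u _ => ?_
    exact (Finset.card_le_card Finset.inter_subset_left).trans
      ((G.card_neighborFinset_eq_degree u).le.trans (hd u))
  have h3 : (∑ v ∈ S, ((G.neighborFinset v ∩ U).card : ℝ)) ≤ (U.card : ℝ) * d := by
    exact_mod_cast h2
  linarith

/-- One merging step.  If every vertex outside `B` has at least `D` unused neighbours in the reserve
`R`, then a path system with more than `|R| / D + |B| / s` members can be shortened by one path.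
Unless some path has fewer than `s` vertices, all but `|B| / s` of the paths have a vertex outside
`B` among their first `s` vertices, and the unused neighbourhoods of these vertices cannot all be
disjoint. -/
theorem IsPathSystem.exists_merge (h : IsPathSystem G 𝓛) {R B : Finset V} {s : ℕ} {D : ℝ}
    (hs : 0 < s) (hD : 0 < D)
    (hgood : ∀ v ∉ B, D ≤ ((G.neighborFinset v ∩ (R \ covered 𝓛)).card : ℝ))
    (hT : (R.card : ℝ) / D + (B.card : ℝ) / s < 𝓛.card) :
    ∃ 𝓜, IsPathSystem G 𝓜 ∧ 𝓜.card + 1 = 𝓛.card ∧ covered 𝓜 ⊆ covered 𝓛 ∪ R ∧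
      (covered 𝓛).card ≤ (covered 𝓜).card + 2 * s ∧
      (R ∩ covered 𝓜).card ≤ (R ∩ covered 𝓛).card + 1 := by
  by_cases hshort : ∃ l ∈ 𝓛, l.length < s
  · obtain ⟨l, hl, hls⟩ := hshort
    refine ⟨𝓛.erase l, h.mono (Finset.erase_subset l 𝓛), Finset.card_erase_add_one hl, ?_, ?_, ?_⟩
    · exact (covered_mono (Finset.erase_subset l 𝓛)).trans Finset.subset_union_left
    · have := h.card_covered_erase hl
      omega
    · exact (Finset.card_le_card (Finset.inter_subset_inter_left
        (covered_mono (Finset.erase_subset l 𝓛)))).trans (Nat.le_succ _)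
  push Not at hshort
  set 𝓑 := 𝓛.filter fun l => ∀ v ∈ l.take s, v ∈ B with h𝓑
  set 𝓖 := 𝓛.filter fun l => ¬ ∀ v ∈ l.take s, v ∈ B with h𝓖
  have hsplit : 𝓑.card + 𝓖.card = 𝓛.card := Finset.card_filter_add_card_filter_not _
  have hBcard : 𝓑.card * s ≤ B.card :=
    (h.mono (Finset.filter_subset _ _)).card_mul_le_of_take_subset
      (fun l hl => hshort l (Finset.mem_filter.1 hl).1) fun l hl => (Finset.mem_filter.1 hl).2
  have hs' : (0 : ℝ) < s := by exact_mod_cast hs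
  have hBr : (𝓑.card : ℝ) ≤ (B.card : ℝ) / s := by
    rw [le_div_iff₀ hs']; exact_mod_cast hBcard
  have hGr : (R.card : ℝ) / D < 𝓖.card := by
    have : (𝓑.card : ℝ) + 𝓖.card = 𝓛.card := by exact_mod_cast hsplit
    linarith
  have hex : ∀ l : List V, ∃ x, l ∈ 𝓖 → x ∈ l.take s ∧ x ∉ B := by
    intro l
    by_cases hl : l ∈ 𝓖
    · have := (Finset.mem_filter.1 hl).2
      push Not at this
      obtain ⟨x, hx⟩ := this
      exact ⟨x, fun _ => hx⟩
    · obtain ⟨l', hl'⟩ : 𝓖.Nonempty := by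
        rw [← Finset.card_pos]
        have : (0 : ℝ) ≤ R.card / D := by positivity
        exact_mod_cast this.trans_lt hGr
      have := (Finset.mem_filter.1 hl').2
      push Not at this
      obtain ⟨x, hx⟩ := this
      exact ⟨x, fun hh => absurd hh hl⟩
  choose x hx using hex
  have hcommon : ∃ l ∈ 𝓖, ∃ m ∈ 𝓖, l ≠ m ∧ ∃ u ∈ R \ covered 𝓛, G.Adj (x l) u ∧ G.Adj u (x m) := by
    by_contra hno
    push Not at hno
    have hdisj : (𝓖 : Set (List V)).PairwiseDisjoint
        fun l => G.neighborFinset (x l) ∩ (R \ covered 𝓛) := by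
      intro l hl m hm hne
      refine Finset.disjoint_left.2 fun u hu hu' => ?_
      rw [Finset.mem_inter, SimpleGraph.mem_neighborFinset] at hu hu'
      exact hno l hl m hm hne u hu.2 hu.1 hu'.1.symm
    have h1 := Finset.card_biUnion hdisj
    have h2 : (𝓖.biUnion fun l => G.neighborFinset (x l) ∩ (R \ covered 𝓛)).card ≤ R.card := by
      refine Finset.card_le_card fun u hu => ?_
      obtain ⟨l, -, hu⟩ := Finset.mem_biUnion.1 hu
      exact (Finset.mem_sdiff.1 (Finset.mem_inter.1 hu).2).1
    have h3 : (𝓖.card : ℝ) * D ≤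
        ∑ l ∈ 𝓖, ((G.neighborFinset (x l) ∩ (R \ covered 𝓛)).card : ℝ) := by
      rw [← nsmul_eq_mul]
      exact Finset.card_nsmul_le_sum 𝓖 _ _ fun l hl => hgood _ (hx l hl).2
    have h4 : (𝓖.card : ℝ) * D ≤ R.card := by
      refine h3.trans ?_
      rw [h1] at h2
      exact_mod_cast h2
    rw [div_lt_iff₀ hD] at hGr
    linarith
  obtain ⟨l, hl, m, hm, hne, u, hu, hlu, hum⟩ := hcommon
  obtain ⟨l₁, l₂, hleq, hl₁⟩ := List.exists_eq_append_cons_of_mem_take (hx l hl).1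
  obtain ⟨m₁, m₂, hmeq, hm₁⟩ := List.exists_eq_append_cons_of_mem_take (hx m hm).1
  have hl𝓛 := (Finset.mem_filter.1 hl).1
  have hm𝓛 := (Finset.mem_filter.1 hm).1
  rw [Finset.mem_sdiff] at hu
  obtain ⟨𝓜, hM, hcard, hcov, hlen⟩ := h.join (w := [u]) (hleq ▸ hl𝓛) (hmeq ▸ hm𝓛)
    (fun e => hne (hleq.trans (e.trans hmeq.symm))) (by simp) (by simp [hlu, hum])
    (by simpa using hu.2)
  refine ⟨𝓜, hM, hcard, hcov.trans (Finset.union_subset_union_right ?_), by omega, ?_⟩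
  · simpa using hu.1
  · have : R ∩ covered 𝓜 ⊆ Insert.insert u (R ∩ covered 𝓛) := by
      intro v hv
      rw [Finset.mem_inter] at hv
      have := hcov hv.2
      simp only [List.toFinset_cons, List.toFinset_nil, insert_empty_eq, Finset.mem_union,
        Finset.mem_singleton] at this
      rw [Finset.mem_insert, Finset.mem_inter]
      tauto
    exact (Finset.card_le_card this).trans (Finset.card_insert_le _ _)

/-- Repeated merging through a reserve `R` in which every vertex outside `B` has at least `Dr`
neighbours.  The parameter `τ` is the loss of degree into `R` that is tolerated when vertices of
`R` get used; at most `p` of them ever are, so few vertices lose more than `τ`. -/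
theorem IsPathSystem.exists_merged {d : ℕ} (hd : ∀ v, G.degree v ≤ d) (h : IsPathSystem G 𝓛)
    {R B : Finset V} {Dr τ : ℝ} (hτ : 0 < τ) (hτD : τ < Dr)
    (hB : ∀ v ∉ B, Dr ≤ ((G.neighborFinset v ∩ R).card : ℝ)) {s : ℕ} (hs : 0 < s) {p : ℕ}
    (hp : (R ∩ covered 𝓛).card + 𝓛.card ≤ p) :
    ∃ 𝓜, IsPathSystem G 𝓜 ∧ covered 𝓜 ⊆ covered 𝓛 ∪ R ∧
      (covered 𝓛).card ≤ (covered 𝓜).card + 2 * s * 𝓛.card ∧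
      (𝓜.card : ℝ) ≤ R.card / (Dr - τ) + (B.card + d * p / τ) / s := by
  induction hk : 𝓛.card generalizing 𝓛 with
  | zero =>
    refine ⟨𝓛, h, Finset.subset_union_left, by omega, ?_⟩
    have : 0 < Dr - τ := by linarith
    rw [hk, Nat.cast_zero]
    positivity
  | succ k ih =>
    by_cases hT : (𝓛.card : ℝ) ≤ R.card / (Dr - τ) + (B.card + d * p / τ) / s
    · exact ⟨𝓛, h, Finset.subset_union_left, by omega, hT⟩
    push Not at hT
    set E := Finset.univ.filter fun v => τ < ((G.neighborFinset v ∩ (R ∩ covered 𝓛)).card : ℝ)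
    have hE : (E.card : ℝ) ≤ d * p / τ := by
      rw [le_div_iff₀ hτ]
      refine (card_filter_lt_card_inter_mul_le hd (R ∩ covered 𝓛) τ).trans ?_
      have : (R ∩ covered 𝓛).card ≤ p := by omega
      gcongr
    have hBE : ((B ∪ E).card : ℝ) ≤ B.card + d * p / τ := by
      have : ((B ∪ E).card : ℝ) ≤ B.card + E.card := by exact_mod_cast Finset.card_union_le B E
      linarith
    have hgood : ∀ v ∉ B ∪ E,
        Dr - τ ≤ ((G.neighborFinset v ∩ (R \ covered 𝓛)).card : ℝ) := by
      intro v hv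
      rw [Finset.mem_union, not_or] at hv
      have h1 := hB v hv.1
      have h2 : ((G.neighborFinset v ∩ (R ∩ covered 𝓛)).card : ℝ) ≤ τ := by
        by_contra hcon
        exact hv.2 (Finset.mem_filter.2 ⟨Finset.mem_univ v, not_le.1 hcon⟩)
      have h3 : (G.neighborFinset v ∩ R).card ≤ (G.neighborFinset v ∩ (R \ covered 𝓛)).card +
          (G.neighborFinset v ∩ (R ∩ covered 𝓛)).card := by
        refine (Finset.card_le_card fun u hu => ?_).trans (Finset.card_union_le _ _)
        simp only [Finset.mem_union, Finset.mem_inter, Finset.mem_sdiff] at hu ⊢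
        tauto
      have h4 : ((G.neighborFinset v ∩ R).card : ℝ) ≤
          (G.neighborFinset v ∩ (R \ covered 𝓛)).card +
          (G.neighborFinset v ∩ (R ∩ covered 𝓛)).card := by exact_mod_cast h3
      linarith
    have hT' : (R.card : ℝ) / (Dr - τ) + ((B ∪ E).card : ℝ) / s < 𝓛.card := by
      refine lt_of_le_of_lt ?_ hT
      gcongr
    obtain ⟨𝓝, hN, hNc, hNcov, hNlen, hNR⟩ := h.exists_merge hs (by linarith) hgood hT'
    obtain ⟨𝓜, hM, hMcov, hMlen, hMT⟩ := ih hN (by omega) (by omega)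
    refine ⟨𝓜, hM, ?_, ?_, hMT⟩
    · exact hMcov.trans (Finset.union_subset hNcov Finset.subset_union_right)
    · nlinarith

end Merge

/-! ### A first path system from a matching between consecutive classes -/

section LinearForest

variable {V : Type*} [DecidableEq V] {G : SimpleGraph V}

/-- An injective partial predecessor map along edges, decreasing a rank, splits its domain `A` into
paths, one for each vertex without a predecessor.  The last clause, that a vertex which is nobody's
predecessor is the head of its list, is what the induction needs. -/
theorem exists_isPathSystem_of_pred (pred : V → Option V) (rank : V → ℕ) (A : Finset V)
    (hpred : ∀ v ∈ A, ∀ u, pred v = some u → u ∈ A ∧ G.Adj v u ∧ rank u < rank v)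
    (hinj : ∀ v ∈ A, ∀ w ∈ A, ∀ u, pred v = some u → pred w = some u → v = w) :
    ∃ 𝓛, IsPathSystem G 𝓛 ∧ covered 𝓛 = A ∧ 𝓛.card = (A.filter fun v => pred v = none).card ∧
      ∀ u ∈ A, (∀ v ∈ A, pred v ≠ some u) → ∃ l, u :: l ∈ 𝓛 := by
  induction A using Finset.induction_on_max_value rank with
  | empty => exact ⟨∅, isPathSystem_empty G, by simp [covered], by simp, by simp⟩
  | insert a S ha hmax ih =>
    have hS : ∀ v ∈ S, ∀ u, pred v = some u → u ∈ S ∧ G.Adj v u ∧ rank u < rank v := by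
      intro v hv u hu
      obtain ⟨h1, h2, h3⟩ := hpred v (Finset.mem_insert_of_mem hv) u hu
      refine ⟨(Finset.mem_insert.1 h1).resolve_left ?_, h2, h3⟩
      rintro rfl
      exact absurd (hmax v hv) (by omega)
    obtain ⟨𝓛, h, hcov, hcard, hhead⟩ := ih hS fun v hv w hw =>
      hinj v (Finset.mem_insert_of_mem hv) w (Finset.mem_insert_of_mem hw)
    cases hpa : pred a with
    | none =>
      have hd : ∀ v ∈ [a], v ∉ covered 𝓛 := by simpa [hcov] using ha
      have hn : [a] ∉ 𝓛 := not_mem_of_disjoint_covered (by simp) hd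
      refine ⟨insert [a] 𝓛, h.insert (by simp) (by simp) (by simp) hd, ?_, ?_, ?_⟩
      · rw [covered_insert, hcov]; rfl
      · rw [Finset.card_insert_of_notMem hn, hcard, Finset.filter_insert, if_pos hpa,
          Finset.card_insert_of_notMem (by simp [ha])]
      · intro u hu hno
        rcases Finset.mem_insert.1 hu with rfl | hu
        · exact ⟨[], Finset.mem_insert_self _ _⟩
        · obtain ⟨l, hl⟩ := hhead u hu fun v hv => hno v (Finset.mem_insert_of_mem hv)
          exact ⟨l, Finset.mem_insert_of_mem hl⟩
    | some u =>
      have haS := Finset.mem_insert_self a S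
      obtain ⟨huA, hau, hlt⟩ := hpred a haS u hpa
      have huS : u ∈ S := (Finset.mem_insert.1 huA).resolve_left hau.ne'
      obtain ⟨l, hl⟩ := hhead u huS fun v hv hvu => ha
        (hinj v (Finset.mem_insert_of_mem hv) a haS u hvu hpa ▸ hv)
      have hE := h.mono (Finset.erase_subset (u :: l) 𝓛)
      have hcovE : covered (𝓛.erase (u :: l)) ⊆ S := hcov ▸ covered_mono (Finset.erase_subset _ _)
      have hlS : ∀ v ∈ u :: l, v ∈ S := fun v hv => hcov ▸ mem_covered.2 ⟨_, hl, hv⟩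
      have hd : ∀ v ∈ a :: u :: l, v ∉ covered (𝓛.erase (u :: l)) := by
        intro v hv
        rcases List.mem_cons.1 hv with rfl | hv
        · exact fun hv' => ha (hcovE hv')
        · exact h.disjoint_covered_erase hl v hv
      have hn : a :: u :: l ∉ 𝓛.erase (u :: l) := not_mem_of_disjoint_covered (by simp) hd
      refine ⟨insert (a :: u :: l) (𝓛.erase (u :: l)),
        hE.insert (by simp) (List.nodup_cons.2 ⟨fun hv => ha (hlS a hv), h.nodup _ hl⟩)
          (List.isChain_cons_cons.2 ⟨hau, h.chain _ hl⟩) hd, ?_, ?_, ?_⟩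
      · have : covered 𝓛 = (u :: l).toFinset ∪ covered (𝓛.erase (u :: l)) := by
          rw [← covered_insert, Finset.insert_erase hl]
        rw [covered_insert, ← hcov, this, List.toFinset_cons, Finset.insert_union]
      · rw [Finset.card_insert_of_notMem hn, Finset.card_erase_add_one hl, hcard,
          Finset.filter_insert, if_neg (by simp [hpa])]
      · intro w hw hno
        rcases Finset.mem_insert.1 hw with rfl | hw
        · exact ⟨u :: l, Finset.mem_insert_self _ _⟩
        · obtain ⟨l', hl'⟩ := hhead w hw fun v hv => hno v (Finset.mem_insert_of_mem hv)
          refine ⟨l', Finset.mem_insert_of_mem (Finset.mem_erase.2 ⟨?_, hl'⟩)⟩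
          intro heq
          rw [List.cons.injEq] at heq
          exact hno a haS (heq.1 ▸ hpa)

/-- Hall's theorem with deficiency: if every set of indices has at most `k` fewer neighbours than
elements, then all but `k` indices can be matched. -/
theorem exists_partial_matching {ι α : Type*} [Fintype ι] [DecidableEq α]
    (t : ι → Finset α) (k : ℕ) (h : ∀ S : Finset ι, S.card ≤ (S.biUnion t).card + k) :
    ∃ f : ι → Option α, (∀ i a, f i = some a → a ∈ t i) ∧
      (∀ i j a, f i = some a → f j = some a → i = j) ∧
      (Finset.univ.filter fun i => f i = none).card ≤ k := by
  classical
  -- adding `k` dummy elements adjacent to every index makes Hall's condition hold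
  set t' : ι → Finset (α ⊕ Fin k) := fun i => (t i).disjSum Finset.univ
  have hall : ∀ S : Finset ι, S.card ≤ (S.biUnion t').card := by
    intro S
    rcases S.eq_empty_or_nonempty with rfl | ⟨i₀, hi₀⟩
    · simp
    · have : (S.biUnion t).disjSum (Finset.univ : Finset (Fin k)) ⊆ S.biUnion t' := by
        intro x hx
        rw [Finset.mem_disjSum] at hx
        rcases hx with ⟨a, ha, rfl⟩ | ⟨b, -, rfl⟩
        · obtain ⟨i, hi, hai⟩ := Finset.mem_biUnion.1 ha
          exact Finset.mem_biUnion.2 ⟨i, hi, Finset.inl_mem_disjSum.2 hai⟩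
        · exact Finset.mem_biUnion.2 ⟨i₀, hi₀, Finset.inr_mem_disjSum.2 (Finset.mem_univ b)⟩
      have h1 := Finset.card_le_card this
      rw [Finset.card_disjSum, Finset.card_univ, Fintype.card_fin] at h1
      exact (h S).trans h1
  obtain ⟨f, hf, hft⟩ := (Finset.all_card_le_biUnion_card_iff_exists_injective t').1 hall
  refine ⟨fun i => (f i).getLeft?, ?_, ?_, ?_⟩
  · intro i a hi
    rw [Sum.getLeft?_eq_some_iff] at hi
    have := hft i
    rw [hi] at this
    exact Finset.inl_mem_disjSum.1 this
  · intro i j a hi hj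
    rw [Sum.getLeft?_eq_some_iff] at hi hj
    exact hf (hi.trans hj.symm)
  · have hcard : (Finset.univ.filter fun i => (f i).getLeft? = none).card ≤
        ((Finset.univ : Finset (Fin k)).image (Sum.inr : Fin k → α ⊕ Fin k)).card := by
      refine Finset.card_le_card_of_injOn f ?_ hf.injOn
      intro i hi
      have hi' := (Finset.mem_filter.1 hi).2
      cases hfi : f i with
      | inl a => simp [hfi] at hi'
      | inr b => exact Finset.mem_coe.2 (Finset.mem_image_of_mem _ (Finset.mem_univ b))
    exact hcard.trans (Finset.card_image_le.trans (by simp))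

/-- If the levels `r = 0, …, k - 1` satisfy Hall's condition with deficiency `t` towards the level
below, then they are covered by at most `t` more paths than there are vertices of level `0`. -/
theorem exists_isPathSystem_of_levels [Fintype V] [DecidableRel G.Adj] (r : V → ℕ) (k t : ℕ)
    (hall : ∀ S : Finset V, (∀ v ∈ S, 0 < r v ∧ r v < k) →
      S.card ≤ (Finset.univ.filter fun u => ∃ v ∈ S, G.Adj v u ∧ r u + 1 = r v).card + t) :
    ∃ 𝓛, IsPathSystem G 𝓛 ∧ covered 𝓛 = Finset.univ.filter (fun v => r v < k) ∧
      𝓛.card ≤ (Finset.univ.filter fun v => r v = 0).card + t := by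
  classical
  obtain ⟨f, hft, hfinj, hfnone⟩ := exists_partial_matching
    (ι := {v : V // 0 < r v ∧ r v < k})
    (fun v => Finset.univ.filter fun u => G.Adj v.1 u ∧ r u + 1 = r v.1) t (by
      intro S
      have h1 := hall (S.map (Function.Embedding.subtype _)) (by
        intro v hv
        obtain ⟨w, -, rfl⟩ := Finset.mem_map.1 hv
        exact w.2)
      rw [Finset.card_map] at h1
      refine h1.trans (Nat.add_le_add_right (Finset.card_le_card fun u hu => ?_) t)
      obtain ⟨-, v, hv, huv⟩ := Finset.mem_filter.1 hu
      obtain ⟨w, hw, rfl⟩ := Finset.mem_map.1 hv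
      exact Finset.mem_biUnion.2 ⟨w, hw, Finset.mem_filter.2 ⟨Finset.mem_univ u, huv⟩⟩)
  set pred : V → Option V := fun v => if hv : 0 < r v ∧ r v < k then f ⟨v, hv⟩ else none
  have hsome : ∀ v u, pred v = some u → ∃ hv : 0 < r v ∧ r v < k, f ⟨v, hv⟩ = some u := by
    intro v u hvu
    by_cases hv : 0 < r v ∧ r v < k
    · exact ⟨hv, by simpa [pred, hv] using hvu⟩
    · simp [pred, hv] at hvu
  obtain ⟨𝓛, h, hcov, hcard, -⟩ := exists_isPathSystem_of_pred (G := G) pred r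
    (Finset.univ.filter fun v => r v < k) (by
      intro v _ u hvu
      obtain ⟨hv, hf⟩ := hsome v u hvu
      obtain ⟨-, hadj, hr⟩ := Finset.mem_filter.1 (hft _ _ hf)
      simp only at hr
      exact ⟨Finset.mem_filter.2 ⟨Finset.mem_univ u, by omega⟩, hadj, by omega⟩) (by
      intro v _ w _ u hvu hwu
      obtain ⟨hv, hf⟩ := hsome v u hvu
      obtain ⟨hw, hf'⟩ := hsome w u hwu
      exact congrArg Subtype.val (hfinj _ _ u hf hf'))
  refine ⟨𝓛, h, hcov, ?_⟩
  rw [hcard]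
  have hsub : (Finset.univ.filter fun v => r v < k).filter (fun v => pred v = none) ⊆
      (Finset.univ.filter fun v => r v = 0) ∪
        (Finset.univ.filter fun i => f i = none).map (Function.Embedding.subtype _) := by
    intro v hv
    simp only [Finset.mem_filter, Finset.mem_univ, true_and] at hv
    rcases Nat.eq_zero_or_pos (r v) with h0 | h0
    · exact Finset.mem_union_left _ (Finset.mem_filter.2 ⟨Finset.mem_univ v, h0⟩)
    · refine Finset.mem_union_right _ (Finset.mem_map.2 ⟨⟨v, h0, hv.1⟩, ?_, rfl⟩)
      have := hv.2
      simp only [pred, dif_pos (And.intro h0 hv.1)] at this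
      exact Finset.mem_filter.2 ⟨Finset.mem_univ _, this⟩
  refine (Finset.card_le_card hsub).trans ((Finset.card_union_le _ _).trans ?_)
  rw [Finset.card_map]
  exact Nat.add_le_add_left hfnone _

end LinearForest

/-! ### Equitable colourings -/

section Coloring

variable {V K : Type*} [Fintype K] [DecidableEq K]

/-- The number of pairs of elements of `N` with the same colour, as a sum of squares. -/
theorem sum_card_filter_sq (N : Finset V) (c : V → K) :
    ∑ i : K, ((N.filter fun u => c u = i).card : ℝ) ^ 2 =
      ∑ y ∈ N, ∑ z ∈ N, if c y = c z then (1 : ℝ) else 0 := by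
  have h1 : ∀ i : K, ((N.filter fun u => c u = i).card : ℝ) ^ 2 =
      ∑ y ∈ N, ∑ z ∈ N, (if c y = i then (1 : ℝ) else 0) * (if c z = i then 1 else 0) := by
    intro i
    rw [← Finset.sum_mul_sum, sq, Finset.sum_boole]
  simp_rw [h1]
  rw [Finset.sum_comm]
  refine Finset.sum_congr rfl fun y _ => ?_
  rw [Finset.sum_comm]
  refine Finset.sum_congr rfl fun z _ => ?_
  simp [eq_comm]

theorem sum_deviation_sq (N : Finset V) (c : V → K) [Nonempty K] :
    ∑ i : K, (((N.filter fun u => c u = i).card : ℝ) - N.card / Fintype.card K) ^ 2 =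
      (∑ y ∈ N, ∑ z ∈ N, if c y = c z then (1 : ℝ) else 0) -
        (N.card : ℝ) ^ 2 / Fintype.card K := by
  have hm : (Fintype.card K : ℝ) ≠ 0 := by exact_mod_cast Fintype.card_ne_zero
  have h0 : ∑ i : K, ((N.filter fun u => c u = i).card : ℝ) = N.card := by
    exact_mod_cast (Finset.card_eq_sum_card_fiberwise (f := c) (s := N) (t := Finset.univ)
      (fun _ _ => Finset.mem_coe.2 (Finset.mem_univ _))).symm
  simp_rw [sub_sq]
  rw [Finset.sum_add_distrib, Finset.sum_sub_distrib, sum_card_filter_sq]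
  have h2 : ∑ i : K, 2 * ((N.filter fun u => c u = i).card : ℝ) * (N.card / Fintype.card K) =
      2 * (N.card : ℝ) ^ 2 / Fintype.card K := by
    rw [← Finset.sum_mul, ← Finset.mul_sum, h0]; ring
  rw [h2, Finset.sum_const, Finset.card_univ, nsmul_eq_mul]
  field_simp
  ring

variable [Fintype V] [DecidableEq V]

theorem card_coloring_eq_mul_card {y z : V} (hyz : y ≠ z) :
    (Finset.univ.filter fun c : V → K => c y = c z).card * Fintype.card K =
      Fintype.card (V → K) := by
  rw [← Fintype.card_coe, ← Fintype.card_prod]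
  refine Fintype.card_congr
    { toFun := fun p => Function.update p.1.1 y p.2
      invFun := fun c => (⟨Function.update c y (c z), by simp [Function.update_of_ne hyz.symm]⟩, c y)
      left_inv := ?_
      right_inv := ?_ }
  · rintro ⟨⟨c, hc⟩, k⟩
    have hc' := (Finset.mem_filter.1 hc).2
    ext v
    · by_cases hv : v = y
      · subst hv; simp [Function.update_of_ne hyz.symm, hc']
      · simp [Function.update_of_ne hv]
    · simp
  · intro c
    simp

/-- On average over all colourings, the number of neighbours in each colour class deviates from its
mean no more than a sum of pairwise independent indicators does. -/
theorem sum_sum_deviation_sq_le (N : Finset V) [Nonempty K] :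
    ∑ c : V → K, ∑ i : K,
        (((N.filter fun u => c u = i).card : ℝ) - N.card / Fintype.card K) ^ 2 ≤
      Fintype.card (V → K) * N.card := by
  have hm : (0 : ℝ) < Fintype.card K := by exact_mod_cast Fintype.card_pos
  set T : ℝ := (Fintype.card (V → K) : ℝ)
  have hT : 0 ≤ T := by positivity
  simp_rw [sum_deviation_sq]
  rw [Finset.sum_sub_distrib, Finset.sum_const, Finset.card_univ, nsmul_eq_mul]
  have h1 : ∑ c : V → K, ∑ y ∈ N, ∑ z ∈ N, (if c y = c z then (1 : ℝ) else 0) ≤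
      ∑ y ∈ N, ∑ z ∈ N, ((if y = z then T else 0) + T / Fintype.card K) := by
    rw [Finset.sum_comm]
    refine Finset.sum_le_sum fun y _ => ?_
    rw [Finset.sum_comm]
    refine Finset.sum_le_sum fun z _ => ?_
    rw [Finset.sum_boole]
    by_cases hyz : y = z
    · subst hyz
      have : 0 ≤ T / Fintype.card K := by positivity
      simp only [Finset.filter_true, if_true, Finset.card_univ]
      linarith
    · rw [if_neg hyz, zero_add, le_div_iff₀ hm]
      have := (card_coloring_eq_mul_card (K := K) hyz).le
      simp only [T]
      exact_mod_cast this
  have h2 : ∑ y ∈ N, ∑ z ∈ N, ((if y = z then T else 0) + T / Fintype.card K) =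
      T * N.card + T * ((N.card : ℝ) ^ 2 / Fintype.card K) := by
    simp only [Finset.sum_add_distrib, Finset.sum_ite_eq, Finset.sum_const, nsmul_eq_mul]
    rw [Finset.sum_ite_mem, Finset.inter_self, Finset.sum_const, nsmul_eq_mul]
    ring
  linarith

/-- The colouring `c` is equitable in the `d`-regular graph `G` apart from the exceptional set `B`:
with `m` colours, every vertex outside `B` has in each colour `d / m` neighbours up to a relative
error `1 / m`, and `B` contains at most a proportion `m ^ 4 / d` of the vertices. -/
structure IsEquitable (G : SimpleGraph V) [DecidableRel G.Adj] (d : ℕ) (c : V → K)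
    (B : Finset V) : Prop where
  card_le : (B.card : ℝ) ≤ Fintype.card V * (Fintype.card K : ℝ) ^ 4 / d
  deviation_le : ∀ v ∉ B, ∀ i, |(((G.neighborFinset v).filter fun u => c u = i).card : ℝ) -
    d / Fintype.card K| ≤ d / (Fintype.card K : ℝ) ^ 2

theorem exists_isEquitable (G : SimpleGraph V) [DecidableRel G.Adj] {d : ℕ} (hd0 : 0 < d)
    (hd : G.IsRegularOfDegree d) (K : Type*) [Fintype K] [DecidableEq K] [Nonempty K] :
    ∃ (c : V → K) (B : Finset V), IsEquitable G d c B := by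
  set m : ℝ := (Fintype.card K : ℝ)
  have hm : 0 < m := by simp only [m]; exact_mod_cast Fintype.card_pos
  have hdr : (0 : ℝ) < d := by exact_mod_cast hd0
  set n : ℝ := (Fintype.card V : ℝ)
  set dev : (V → K) → V → K → ℝ := fun c v i =>
    (((G.neighborFinset v).filter fun u => c u = i).card : ℝ) - d / m
  have htot : ∑ c : V → K, ∑ v : V, ∑ i : K, dev c v i ^ 2 ≤ ∑ _c : V → K, n * d := by
    rw [Finset.sum_comm]
    have : ∀ v ∈ (Finset.univ : Finset V), ∑ c : V → K, ∑ i : K, dev c v i ^ 2 ≤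
        Fintype.card (V → K) * (d : ℝ) := by
      intro v _
      have := sum_sum_deviation_sq_le (K := K) (G.neighborFinset v)
      rwa [G.card_neighborFinset_eq_degree, hd v] at this
    refine (Finset.sum_le_sum this).trans (le_of_eq ?_)
    simp only [Finset.sum_const, Finset.card_univ, nsmul_eq_mul, n]
    ring
  obtain ⟨c, -, hc⟩ := Finset.exists_le_of_sum_le
    (s := (Finset.univ : Finset (V → K))) Finset.univ_nonempty htot
  refine ⟨c, Finset.univ.filter fun v => ∃ i, d / m ^ 2 < |dev c v i|, ?_, ?_⟩
  · set B := Finset.univ.filter fun v => ∃ i, d / m ^ 2 < |dev c v i|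
    have h1 : (B.card : ℝ) * (d / m ^ 2) ^ 2 ≤ ∑ v ∈ B, ∑ i : K, dev c v i ^ 2 := by
      rw [← nsmul_eq_mul]
      refine Finset.card_nsmul_le_sum B _ _ fun v hv => ?_
      obtain ⟨i, hi⟩ := (Finset.mem_filter.1 hv).2
      calc (d / m ^ 2) ^ 2 ≤ |dev c v i| ^ 2 := by gcongr
        _ = dev c v i ^ 2 := sq_abs _
        _ ≤ ∑ i : K, dev c v i ^ 2 :=
          Finset.single_le_sum (f := fun i => dev c v i ^ 2) (fun j _ => sq_nonneg _)
            (Finset.mem_univ i)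
    have h2 : ∑ v ∈ B, ∑ i : K, dev c v i ^ 2 ≤ ∑ v : V, ∑ i : K, dev c v i ^ 2 :=
      Finset.sum_le_sum_of_subset_of_nonneg (Finset.subset_univ B)
        fun v _ _ => Finset.sum_nonneg fun i _ => sq_nonneg _
    have h3 : (B.card : ℝ) * (d / m ^ 2) ^ 2 ≤ n * d := h1.trans (h2.trans hc)
    rw [le_div_iff₀ hdr]
    have h4 : (B.card : ℝ) * (d / m ^ 2) ^ 2 * (m ^ 4 / d) ≤ n * d * (m ^ 4 / d) := by gcongr
    have e1 : (B.card : ℝ) * (d / m ^ 2) ^ 2 * (m ^ 4 / d) = B.card * d := by field_simp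
    have e2 : n * d * (m ^ 4 / d) = n * m ^ 4 := by field_simp
    linarith
  · intro v hv i
    by_contra hcon
    exact hv (Finset.mem_filter.2 ⟨Finset.mem_univ v, i, not_le.1 hcon⟩)

end Coloring

/-! ### Consequences of equitability -/

section Equitable

variable {V K : Type*} [Fintype V] [Fintype K] [DecidableEq K]
  {G : SimpleGraph V} [DecidableRel G.Adj] {d : ℕ} {c : V → K} {B : Finset V}

theorem IsEquitable.card_filter_le (h : IsEquitable G d c B) {v : V} (hv : v ∉ B) (i : K) :
    (((G.neighborFinset v).filter fun u => c u = i).card : ℝ) ≤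
      d / Fintype.card K + d / (Fintype.card K : ℝ) ^ 2 := by
  have := (abs_le.1 (h.deviation_le v hv i)).2
  linarith

variable [DecidableEq V]

theorem IsEquitable.le_card_inter (h : IsEquitable G d c B) (T : Finset K) {v : V} (hv : v ∉ B) :
    (T.card : ℝ) * (d / Fintype.card K - d / (Fintype.card K : ℝ) ^ 2) ≤
      ((G.neighborFinset v ∩ Finset.univ.filter fun u => c u ∈ T).card : ℝ) := by
  have h1 : (G.neighborFinset v ∩ Finset.univ.filter fun u => c u ∈ T).card =
      ∑ i ∈ T, ((G.neighborFinset v).filter fun u => c u = i).card := by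
    rw [Finset.card_eq_sum_card_fiberwise (f := c) (t := T)]
    · refine Finset.sum_congr rfl fun i hi => congrArg Finset.card ?_
      ext u
      simp only [Finset.mem_filter, Finset.mem_inter, Finset.mem_univ, true_and]
      constructor
      · exact fun hu => ⟨hu.1.1, hu.2⟩
      · exact fun hu => ⟨⟨hu.1, hu.2 ▸ hi⟩, hu.2⟩
    · intro u hu
      simpa using (Finset.mem_filter.1 (Finset.mem_inter.1 (Finset.mem_coe.1 hu)).2).2
  rw [h1, Nat.cast_sum, ← nsmul_eq_mul]
  refine Finset.card_nsmul_le_sum T _ _ fun i _ => ?_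
  have := (abs_le.1 (h.deviation_le v hv i)).1
  linarith

/-- The size of a colour class is controlled by counting the edges that meet it. -/
theorem IsEquitable.card_class_le (h : IsEquitable G d c B) (hd0 : 0 < d)
    (hd : G.IsRegularOfDegree d) (i : K) :
    ((Finset.univ.filter fun v => c v = i).card : ℝ) ≤
      Fintype.card V / Fintype.card K + Fintype.card V / (Fintype.card K : ℝ) ^ 2 + B.card := by
  set C := Finset.univ.filter fun v => c v = i
  have hdr : (0 : ℝ) < d := by exact_mod_cast hd0
  have h1 := sum_card_neighborFinset_inter_comm G C Finset.univ
  have h2 : ∑ v ∈ C, (G.neighborFinset v ∩ Finset.univ).card = C.card * d := by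
    refine Finset.sum_const_nat fun v _ => ?_
    rw [Finset.inter_univ, G.card_neighborFinset_eq_degree, hd v]
  have h3 : ∀ v, G.neighborFinset v ∩ C = (G.neighborFinset v).filter fun u => c u = i := by
    intro v; ext u; simp [C]
  have h4 : ∑ u : V, ((G.neighborFinset u ∩ C).card : ℝ) ≤
      ∑ u : V, ((d / Fintype.card K + d / (Fintype.card K : ℝ) ^ 2) +
        if u ∈ B then (d : ℝ) else 0) := by
    refine Finset.sum_le_sum fun u _ => ?_
    by_cases hu : u ∈ B
    · rw [if_pos hu]
      have : (G.neighborFinset u ∩ C).card ≤ d := by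
        refine (Finset.card_le_card Finset.inter_subset_left).trans ?_
        rw [G.card_neighborFinset_eq_degree, hd u]
      have : ((G.neighborFinset u ∩ C).card : ℝ) ≤ d := by exact_mod_cast this
      have : (0 : ℝ) ≤ d / Fintype.card K + d / (Fintype.card K : ℝ) ^ 2 := by positivity
      linarith
    · rw [if_neg hu, add_zero, h3]
      exact h.card_filter_le hu i
  rw [Finset.sum_add_distrib, Finset.sum_const, Finset.card_univ, nsmul_eq_mul,
    Finset.sum_ite_mem, Finset.univ_inter, Finset.sum_const, nsmul_eq_mul] at h4
  have h5 : (C.card : ℝ) * d = ∑ u : V, ((G.neighborFinset u ∩ C).card : ℝ) := by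
    rw [h2] at h1; exact_mod_cast h1
  rw [← h5] at h4
  refine le_of_mul_le_mul_right (h4.trans (le_of_eq ?_)) hdr
  ring

theorem IsEquitable.card_classes_le (h : IsEquitable G d c B) (hd0 : 0 < d)
    (hd : G.IsRegularOfDegree d) (T : Finset K) :
    ((Finset.univ.filter fun v => c v ∈ T).card : ℝ) ≤ T.card *
      (Fintype.card V / Fintype.card K + Fintype.card V / (Fintype.card K : ℝ) ^ 2 + B.card) := by
  have h1 : (Finset.univ.filter fun v => c v ∈ T).card =
      ∑ i ∈ T, (Finset.univ.filter fun v => c v = i).card := by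
    rw [Finset.card_eq_sum_card_fiberwise (f := c) (t := T)]
    · refine Finset.sum_congr rfl fun i hi => congrArg Finset.card ?_
      ext u
      simp only [Finset.mem_filter, Finset.mem_univ, true_and]
      exact ⟨fun hu => hu.2, fun hu => ⟨hu ▸ hi, hu⟩⟩
    · intro u hu
      simpa using (Finset.mem_filter.1 (Finset.mem_coe.1 hu)).2
  rw [h1, Nat.cast_sum, ← nsmul_eq_mul]
  exact Finset.sum_le_card_nsmul T _ _ fun i _ => h.card_class_le hd0 hd i

/-- The vertices whose colours lie in `T` are covered by few paths: the colours of `T` are put in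
order, and the edges between consecutive classes form almost regular bipartite graphs, so that
Hall's condition holds with small deficiency. -/
theorem IsEquitable.exists_isPathSystem (h : IsEquitable G d c B) (hd0 : 0 < d)
    (hd : G.IsRegularOfDegree d) {T : Finset K} (hT : T.Nonempty) :
    ∃ 𝓛, IsPathSystem G 𝓛 ∧ covered 𝓛 = Finset.univ.filter (fun v => c v ∈ T) ∧
      (𝓛.card : ℝ) ≤ 4 * (Fintype.card V / Fintype.card K) + (Fintype.card K + 2) * B.card := by
  classical
  set m : ℝ := (Fintype.card K : ℝ) with hm
  set n : ℝ := (Fintype.card V : ℝ) with hn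
  set b : ℝ := (B.card : ℝ) with hb
  have hm1 : 1 ≤ m := by
    have : 0 < Fintype.card K := Fintype.card_pos_iff.2 ⟨hT.choose⟩
    simp only [hm]
    exact_mod_cast this
  have hm0 : 0 < m := by linarith
  have hdr : (0 : ℝ) < d := by exact_mod_cast hd0
  set k := T.card
  set ρ : K → ℕ := fun x => if hx : x ∈ T then (T.equivFin ⟨x, hx⟩ : ℕ) else k with hρ
  have hρlt : ∀ x, ρ x < k ↔ x ∈ T := by
    intro x
    by_cases hx : x ∈ T
    · simp [hρ, hx, k, (T.equivFin ⟨x, hx⟩).2]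
    · simp [hρ, hx]
  have hρinj : ∀ x y, ρ x < k → ρ x = ρ y → x = y := by
    intro x y hx hxy
    have hy : y ∈ T := (hρlt y).1 (hxy ▸ hx)
    have hx := (hρlt x).1 hx
    simp only [hρ, dif_pos hx, dif_pos hy] at hxy
    exact congrArg Subtype.val (T.equivFin.injective (Fin.ext hxy))
  have hρsurj : ∀ i < k, ∃ x, ρ x = i := by
    intro i hi
    refine ⟨(T.equivFin.symm ⟨i, hi⟩).1, ?_⟩
    simp [hρ]
  have hk : 0 < k := Finset.card_pos.2 hT
  set t : ℕ := ⌊2 * (n / m) + (m + 1) * b⌋₊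
  have ht : (t : ℝ) ≤ 2 * (n / m) + (m + 1) * b := Nat.floor_le (by positivity)
  obtain ⟨𝓛, h𝓛, hcov, hcard⟩ := exists_isPathSystem_of_levels (G := G) (fun v => ρ (c v)) k t (by
    intro S hS
    set N := Finset.univ.filter fun u => ∃ v ∈ S, G.Adj v u ∧ ρ (c u) + 1 = ρ (c v) with hN
    -- `P v u`: there is an edge from `v` down to `u` in the level below
    set P : V → V → Prop := fun v u => G.Adj v u ∧ ρ (c u) + 1 = ρ (c v)
    have hcount := Finset.sum_card_bipartiteAbove_eq_sum_card_bipartiteBelow (s := S) (t := N) P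
    have hlow : ∀ v ∈ S \ B, d / m - d / m ^ 2 ≤ ((Finset.bipartiteAbove P N v).card : ℝ) := by
      intro v hv
      rw [Finset.mem_sdiff] at hv
      obtain ⟨h0, h1⟩ := hS v hv.1
      obtain ⟨x, hx⟩ := hρsurj (ρ (c v) - 1) (by omega)
      have h2 := (abs_le.1 (h.deviation_le v hv.2 x)).1
      have h3 : ((G.neighborFinset v).filter fun u => c u = x).card ≤
          (Finset.bipartiteAbove P N v).card := by
        refine Finset.card_le_card fun u hu => ?_
        rw [Finset.mem_filter, SimpleGraph.mem_neighborFinset] at hu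
        have hP : P v u := ⟨hu.1, by rw [hu.2, hx]; omega⟩
        exact Finset.mem_filter.2 ⟨Finset.mem_filter.2 ⟨Finset.mem_univ u, v, hv.1, hP⟩, hP⟩
      have h4 : (((G.neighborFinset v).filter fun u => c u = x).card : ℝ) ≤
          (Finset.bipartiteAbove P N v).card := by exact_mod_cast h3
      linarith
    have hup : ∀ u ∈ N, ((Finset.bipartiteBelow P S u).card : ℝ) ≤
        (d / m + d / m ^ 2) + if u ∈ B then (d : ℝ) else 0 := by
      intro u hu
      by_cases huB : u ∈ B
      · rw [if_pos huB]
        have h1 : (Finset.bipartiteBelow P S u).card ≤ d := by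
          rw [← hd u, ← G.card_neighborFinset_eq_degree]
          refine Finset.card_le_card fun v hv => ?_
          rw [SimpleGraph.mem_neighborFinset]
          exact (Finset.mem_filter.1 hv).2.1.symm
        have h2 : ((Finset.bipartiteBelow P S u).card : ℝ) ≤ d := by exact_mod_cast h1
        have : (0 : ℝ) ≤ d / m + d / m ^ 2 := by positivity
        linarith
      · rw [if_neg huB, add_zero]
        obtain ⟨-, v, hv, -, hvu⟩ := Finset.mem_filter.1 hu
        have h1 : (Finset.bipartiteBelow P S u).card ≤
            ((G.neighborFinset u).filter fun w => c w = c v).card := by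
          refine Finset.card_le_card fun w hw => ?_
          obtain ⟨hwS, hw1, hw2⟩ := Finset.mem_filter.1 hw
          rw [Finset.mem_filter, SimpleGraph.mem_neighborFinset]
          exact ⟨hw1.symm, hρinj _ _ (hS w hwS).2 (hw2.symm.trans hvu)⟩
        have h2 : ((Finset.bipartiteBelow P S u).card : ℝ) ≤
            ((G.neighborFinset u).filter fun w => c w = c v).card := by exact_mod_cast h1
        exact h2.trans (h.card_filter_le huB (c v))
    have hL : ((S \ B).card : ℝ) * (d / m - d / m ^ 2) ≤
        ∑ v ∈ S, ((Finset.bipartiteAbove P N v).card : ℝ) := by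
      rw [← nsmul_eq_mul]
      refine (Finset.card_nsmul_le_sum (S \ B) _ _ hlow).trans ?_
      exact Finset.sum_le_sum_of_subset_of_nonneg Finset.sdiff_subset fun _ _ _ => by positivity
    have hR : ∑ u ∈ N, ((Finset.bipartiteBelow P S u).card : ℝ) ≤
        N.card * (d / m + d / m ^ 2) + b * d := by
      refine (Finset.sum_le_sum hup).trans ?_
      rw [Finset.sum_add_distrib, Finset.sum_const, nsmul_eq_mul, Finset.sum_ite_mem,
        Finset.sum_const, nsmul_eq_mul]
      have : ((N ∩ B).card : ℝ) ≤ b := by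
        simp only [hb]; exact_mod_cast Finset.card_le_card Finset.inter_subset_right
      gcongr
    have hLR : ((S \ B).card : ℝ) * (d / m - d / m ^ 2) ≤ N.card * (d / m + d / m ^ 2) + b * d := by
      refine hL.trans (le_trans (le_of_eq ?_) hR)
      exact_mod_cast hcount
    have hSB : (S.card : ℝ) ≤ (S \ B).card + b := by
      have : S.card ≤ (S \ B).card + B.card := by
        have := Finset.le_card_sdiff B S
        omega
      simp only [hb]; exact_mod_cast this
    have hSn : ((S \ B).card : ℝ) ≤ n := by
      simp only [hn]; exact_mod_cast Finset.card_le_univ _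
    have hNn : (N.card : ℝ) ≤ n := by simp only [hn]; exact_mod_cast Finset.card_le_univ _
    have h5 : ((S \ B).card : ℝ) * (1 - 1 / m) ≤ N.card * (1 + 1 / m) + b * m := by
      have e1 : ((S \ B).card : ℝ) * (d / m - d / m ^ 2) =
          ((S \ B).card : ℝ) * (1 - 1 / m) * (d / m) := by field_simp
      have e2 : N.card * (d / m + d / m ^ 2) + b * d = (N.card * (1 + 1 / m) + b * m) * (d / m) := by
        field_simp
      rw [e1, e2] at hLR
      exact le_of_mul_le_mul_right hLR (by positivity)
    have h6 : ((S \ B).card : ℝ) / m ≤ n / m := by gcongr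
    have h7 : (N.card : ℝ) / m ≤ n / m := by gcongr
    have h8 : (S.card : ℝ) - N.card ≤ 2 * (n / m) + (m + 1) * b := by
      have e1 : ((S \ B).card : ℝ) * (1 - 1 / m) = (S \ B).card - (S \ B).card / m := by ring
      have e2 : N.card * (1 + 1 / m) = N.card + N.card / m := by ring
      rw [e1, e2] at h5
      linarith
    have h9 : S.card - N.card ≤ t := by
      rcases le_total N.card S.card with hle | hle
      · refine Nat.le_floor (le_trans (le_of_eq ?_) h8)
        rw [Nat.cast_sub hle]
      · omega
    omega)
  refine ⟨𝓛, h𝓛, ?_, ?_⟩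
  · rw [hcov]
    ext v
    simp [hρlt]
  · obtain ⟨x, hx⟩ := hρsurj 0 hk
    have h1 : (Finset.univ.filter fun v => ρ (c v) = 0) ⊆ Finset.univ.filter fun v => c v = x := by
      intro v hv
      have hv0 := (Finset.mem_filter.1 hv).2
      exact Finset.mem_filter.2 ⟨Finset.mem_univ v, hρinj _ _ (hv0 ▸ hk) (hv0.trans hx.symm)⟩
    have h2 := (Nat.cast_le (α := ℝ)).2 (Finset.card_le_card h1)
    have h3 := h.card_class_le hd0 hd x
    have h4 : n / m ^ 2 ≤ n / m := by
      gcongr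
      exact le_self_pow₀ hm1 two_ne_zero
    have h5 : (𝓛.card : ℝ) ≤ (Finset.univ.filter fun v => ρ (c v) = 0).card + t := by
      exact_mod_cast hcard
    linarith

end Equitable

/-! ### Reserving colour groups and merging -/

section Reserve

variable {V : Type*} [Fintype V] {G : SimpleGraph V} [DecidableRel G.Adj] {d : ℕ}
  {q M : ℕ} {c : V → Fin q × Fin M} {B : Finset V}

variable {m : ℝ}

theorem filter_fst_mem_eq (F : Finset (Fin q)) :
    (Finset.univ.filter fun v => (c v).1 ∈ F) =
      Finset.univ.filter fun v => c v ∈ F ×ˢ (Finset.univ : Finset (Fin M)) := by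
  ext v; simp

theorem IsEquitable.card_le_div_cube (h : IsEquitable G d c B) (hm : m = q * M) (hm0 : 0 < m)
    (hmd : m ^ 7 ≤ d) : (B.card : ℝ) ≤ Fintype.card V / m ^ 3 := by
  have h1 := h.card_le
  rw [Fintype.card_prod, Fintype.card_fin, Fintype.card_fin, Nat.cast_mul, ← hm] at h1
  refine h1.trans ?_
  have hd : (0 : ℝ) < d := lt_of_lt_of_le (by positivity) hmd
  rw [div_le_div_iff₀ hd (by positivity), mul_assoc, ← pow_add]
  gcongr

variable [DecidableEq V]

theorem IsEquitable.le_card_inter_groups (h : IsEquitable G d c B) (hm : m = q * M) (hm0 : 0 < m)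
    (F : Finset (Fin q)) {v : V} (hv : v ∉ B) :
    F.card * (d / q) * (1 - 1 / m) ≤
      ((G.neighborFinset v ∩ Finset.univ.filter fun u => (c u).1 ∈ F).card : ℝ) := by
  have hqM : (q : ℝ) ≠ 0 ∧ (M : ℝ) ≠ 0 := by
    rw [← mul_ne_zero_iff, ← hm]; exact hm0.ne'
  obtain ⟨hq, hM⟩ := hqM
  have h1 := h.le_card_inter (F ×ˢ (Finset.univ : Finset (Fin M))) hv
  rw [← filter_fst_mem_eq, Finset.card_product, Finset.card_univ, Fintype.card_fin,
    Fintype.card_prod, Fintype.card_fin, Fintype.card_fin] at h1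
  push_cast at h1
  refine le_trans (le_of_eq ?_) h1
  rw [hm]
  field_simp

theorem IsEquitable.card_groups_le (h : IsEquitable G d c B) (hm : m = q * M) (hm0 : 0 < m)
    (hmd : m ^ 7 ≤ d) (hd : G.IsRegularOfDegree d) (F : Finset (Fin q)) :
    ((Finset.univ.filter fun v => (c v).1 ∈ F).card : ℝ) ≤
      F.card * (Fintype.card V / q) * (1 + 2 / m) := by
  have hqM : (q : ℝ) ≠ 0 ∧ (M : ℝ) ≠ 0 := by
    rw [← mul_ne_zero_iff, ← hm]; exact hm0.ne'
  obtain ⟨hq, hM⟩ := hqM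
  have hq1 : (1 : ℝ) ≤ q := by exact_mod_cast Nat.one_le_iff_ne_zero.2 (by exact_mod_cast hq)
  have hM1 : (1 : ℝ) ≤ M := by exact_mod_cast Nat.one_le_iff_ne_zero.2 (by exact_mod_cast hM)
  have hm1 : 1 ≤ m := by rw [hm]; nlinarith
  have hdr : (0 : ℝ) < d := lt_of_lt_of_le (by positivity) hmd
  have h1 := h.card_classes_le (by exact_mod_cast hdr) hd (F ×ˢ (Finset.univ : Finset (Fin M)))
  rw [← filter_fst_mem_eq, Finset.card_product, Finset.card_univ, Fintype.card_fin,
    Fintype.card_prod, Fintype.card_fin, Fintype.card_fin] at h1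
  push_cast at h1
  rw [← hm] at h1
  set n : ℝ := (Fintype.card V : ℝ)
  have hB := h.card_le_div_cube hm hm0 hmd
  have h2 : n / m ^ 3 ≤ n / m ^ 2 := by
    gcongr
    norm_num
  refine h1.trans ?_
  have e : F.card * (n / q) * (1 + 2 / m) = F.card * M * (n / m + n / m ^ 2 + n / m ^ 2) := by
    rw [hm]; field_simp; ring
  rw [e]
  gcongr
  exact hB.trans h2

/-- One round of merging, in which the colour group `g` serves as the reserve.  A system of at most
`P n` paths turns into one of about `n / d` paths, up to an error quadratic in `P`; the length of
the initial segments that may be trimmed is chosen so that at most `γ n` vertices are lost. -/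
theorem IsEquitable.exists_round (h : IsEquitable G d c B) (hm : m = q * M) (hm0 : 0 < m)
    (hmd : m ^ 7 ≤ d) (hd : G.IsRegularOfDegree d) {γ P : ℝ} (hγ : 0 < γ) (hγ4 : γ ≤ 1 / 4)
    (hγm : 4 ≤ γ * m) (hP0 : 0 < P) (hP : 2 * P ≤ γ) {𝓛 : Finset (List V)} (h𝓛 : IsPathSystem G 𝓛)
    (hcard : (𝓛.card : ℝ) ≤ P * Fintype.card V) {X : Finset (Fin q)} {g : Fin q} (hg : g ∉ X)
    (hcov : ∀ v ∈ covered 𝓛, (c v).1 ∉ insert g X) :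
    ∃ 𝓜, IsPathSystem G 𝓜 ∧ (∀ v ∈ covered 𝓜, (c v).1 ∉ X) ∧
      ((covered 𝓛).card : ℝ) ≤ (covered 𝓜).card + γ * Fintype.card V ∧
      (𝓜.card : ℝ) ≤ ((1 + 4 * γ) / d + 4 * q / γ ^ 2 * P * (m ^ 4 / d + P)) * Fintype.card V := by
  set n : ℝ := (Fintype.card V : ℝ) with hn
  set R := Finset.univ.filter fun v => (c v).1 ∈ ({g} : Finset (Fin q)) with hR
  have hdr : (0 : ℝ) < d := lt_of_lt_of_le (by positivity) hmd
  have hqM : (q : ℝ) ≠ 0 ∧ (M : ℝ) ≠ 0 := by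
    rw [← mul_ne_zero_iff, ← hm]; exact hm0.ne'
  have hq1 : (1 : ℝ) ≤ q := by exact_mod_cast Nat.one_le_iff_ne_zero.2 (by exact_mod_cast hqM.1)
  have hm4 : 1 / m ≤ γ / 4 := by rw [div_le_div_iff₀ hm0 (by norm_num)]; linarith
  set τ : ℝ := γ * (d / q) with hτ
  set Dr : ℝ := d / q * (1 - 1 / m) with hDr
  have hdq : 0 < (d : ℝ) / q := by positivity
  have hτ0 : 0 < τ := by positivity
  have hDτ : d / q * (1 - 5 / 4 * γ) ≤ Dr - τ := by
    rw [hDr, hτ, mul_comm γ, ← mul_sub]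
    exact mul_le_mul_of_nonneg_left (by linarith) hdq.le
  have hpos : 0 < d / q * (1 - 5 / 4 * γ) := mul_pos hdq (by linarith)
  set s : ℕ := ⌊γ / (2 * P)⌋₊ with hs
  have hx1 : 1 ≤ γ / (2 * P) := by rw [le_div_iff₀ (by positivity)]; linarith
  have hs1 : 1 ≤ s := Nat.one_le_floor_iff _ |>.2 hx1
  have hsle : (s : ℝ) ≤ γ / (2 * P) := Nat.floor_le (by positivity)
  have hsge : γ / (4 * P) ≤ s := by
    have h1 := Nat.lt_floor_add_one (γ / (2 * P))
    rw [← hs] at h1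
    have h2 : γ / (2 * P) = 2 * (γ / (4 * P)) := by field_simp; norm_num
    have h3 : (1 : ℝ) ≤ s := by exact_mod_cast hs1
    linarith
  have hRcov : R ∩ covered 𝓛 = ∅ := by
    ext v
    simp only [hR, Finset.mem_inter, Finset.mem_filter, Finset.mem_univ, true_and,
      Finset.mem_singleton, Finset.notMem_empty, iff_false, not_and]
    intro hv hv'
    exact hcov v hv' (hv ▸ Finset.mem_insert_self _ _)
  obtain ⟨𝓜, hM, hMcov, hMlen, hMcard⟩ := h𝓛.exists_merged (d := d) (fun v => (hd v).le) (R := R)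
    (B := B) (Dr := Dr) hτ0 (by linarith)
    (fun v hv => by simpa [hDr, hR] using h.le_card_inter_groups hm hm0 {g} hv) hs1
    (p := 𝓛.card) (by rw [hRcov]; simp)
  refine ⟨𝓜, hM, ?_, ?_, ?_⟩
  · intro v hv
    rcases Finset.mem_union.1 (hMcov hv) with hv | hv
    · exact fun hX => hcov v hv (Finset.mem_insert_of_mem hX)
    · have := (Finset.mem_filter.1 hv).2
      rw [Finset.mem_singleton] at this
      rwa [this]
  · have h1 : ((covered 𝓛).card : ℝ) ≤ (covered 𝓜).card + 2 * s * 𝓛.card := by exact_mod_cast hMlen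
    have h2 : 2 * (s : ℝ) * 𝓛.card ≤ 2 * (γ / (2 * P)) * (P * n) := by gcongr
    have h3 : 2 * (γ / (2 * P)) * (P * n) = γ * n := by field_simp
    linarith
  · have hRcard : (R.card : ℝ) ≤ n / q * (1 + 2 / m) := by
      simpa [hR, hn] using h.card_groups_le hm hm0 hmd hd {g}
    have hn0 : 0 ≤ n := by positivity
    have h1 : R.card / (Dr - τ) ≤ (1 + 4 * γ) / d * n := by
      have h2 : R.card / (Dr - τ) ≤ n / q * (1 + γ / 2) / (d / q * (1 - 5 / 4 * γ)) := by
        gcongr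
        have : 2 / m = 2 * (1 / m) := by ring
        exact hRcard.trans (mul_le_mul_of_nonneg_left (by linarith) (by positivity))
      refine h2.trans ?_
      rw [div_le_iff₀ hpos]
      have e : (1 + 4 * γ) / d * n * (d / q * (1 - 5 / 4 * γ)) =
          n / q * ((1 + 4 * γ) * (1 - 5 / 4 * γ)) := by
        have := hqM.1
        field_simp
      rw [e]
      gcongr
      nlinarith
    have hB : (B.card : ℝ) ≤ n * (m ^ 4 / d) := by
      have h2 := h.card_le
      rw [Fintype.card_prod, Fintype.card_fin, Fintype.card_fin, Nat.cast_mul, ← hm] at h2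
      rwa [mul_div_assoc] at h2
    have h3 : (B.card + d * 𝓛.card / τ) / s ≤ 4 * q / γ ^ 2 * P * (m ^ 4 / d + P) * n := by
      have h4 : (d : ℝ) * 𝓛.card / τ ≤ q / γ * P * n := by
        have e : (d : ℝ) * 𝓛.card / τ = q / γ * 𝓛.card := by
          have := hqM.1
          rw [hτ]; field_simp
        rw [e, mul_assoc]
        gcongr
      have h5 : (B.card : ℝ) ≤ q / γ * (m ^ 4 / d) * n := by
        have h6 : 1 ≤ q / γ := by rw [le_div_iff₀ hγ]; linarith
        have h7 : 0 ≤ m ^ 4 / d * n := by positivity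
        nlinarith
      calc (B.card + d * 𝓛.card / τ) / s
          ≤ (q / γ * (m ^ 4 / d) * n + q / γ * P * n) / (γ / (4 * P)) := by gcongr
        _ = _ := by field_simp
    rw [add_mul]
    exact hMcard.trans (add_le_add h1 h3)

end Reserve

section Reserve

/-- The arithmetic of one round of merging: with `x = 1 / m`, a bound of order `x ^ a` improves to one
of order `x ^ (a + k)`. -/
theorem quadratic_recursion_le {x A C : ℝ} (hx0 : 0 ≤ x) (hx1 : x ≤ 1) (hA : 0 ≤ A) (hC : 0 ≤ C)
    {a k : ℕ} (hk3 : k ≤ 3) (hka : k ≤ a) (hak : a + k ≤ 7) :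
    2 * x ^ 7 + A * (C * x ^ a) * (x ^ 3 + C * x ^ a) ≤ (2 + A * C * (1 + C)) * x ^ (a + k) := by
  have h1 : x ^ 7 ≤ x ^ (a + k) := pow_le_pow_of_le_one hx0 hx1 hak
  have h2 : x ^ 3 ≤ x ^ k := pow_le_pow_of_le_one hx0 hx1 hk3
  have h3 : x ^ a ≤ x ^ k := pow_le_pow_of_le_one hx0 hx1 hka
  calc 2 * x ^ 7 + A * (C * x ^ a) * (x ^ 3 + C * x ^ a)
      ≤ 2 * x ^ (a + k) + A * (C * x ^ a) * (x ^ k + C * x ^ k) := by gcongr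
    _ = _ := by rw [pow_add]; ring

theorem exists_notMem_of_card_lt {q : ℕ} (X : Finset (Fin q)) (hX : X.card < q) : ∃ g, g ∉ X := by
  by_contra hcon
  push Not at hcon
  rw [Finset.eq_univ_iff_forall.2 hcon, Finset.card_univ, Fintype.card_fin] at hX
  exact lt_irrefl _ hX

variable {V : Type*} [Fintype V] [DecidableEq V] {G : SimpleGraph V} [DecidableRel G.Adj] {d : ℕ}
  {q M : ℕ} {c : V → Fin q × Fin M} {B : Finset V} {m : ℝ}

/-- The colour groups outside `X` are covered by `O(n / m)` paths. -/
theorem IsEquitable.exists_isPathSystem_groups (h : IsEquitable G d c B) (hm : m = q * M)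
    (hm2 : 2 ≤ m) (hmd : m ^ 7 ≤ d) (hd : G.IsRegularOfDegree d) (X : Finset (Fin q))
    (hX : X.card < q) :
    ∃ 𝓛, IsPathSystem G 𝓛 ∧ (∀ v ∈ covered 𝓛, (c v).1 ∉ X) ∧
      (𝓛.card : ℝ) ≤ 7 * (1 / m) ^ 1 * Fintype.card V ∧
      (1 - 2 * (X.card : ℝ) / q) * Fintype.card V ≤ (covered 𝓛).card := by
  obtain ⟨n, hn⟩ : ∃ n : ℝ, n = Fintype.card V := ⟨_, rfl⟩
  have hn0 : 0 ≤ n := by rw [hn]; positivity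
  have hm0 : 0 < m := by linarith
  have hdr : (0 : ℝ) < d := lt_of_lt_of_le (by positivity) hmd
  have hqM : (q : ℝ) ≠ 0 ∧ (M : ℝ) ≠ 0 := by
    rw [← mul_ne_zero_iff, ← hm]; exact hm0.ne'
  have hM0 : 0 < M := Nat.pos_of_ne_zero (by exact_mod_cast hqM.2)
  obtain ⟨g, hg⟩ := exists_notMem_of_card_lt X hX
  set T := Finset.univ.filter fun y : Fin q × Fin M => y.1 ∉ X with hT
  have hTne : T.Nonempty := ⟨(g, ⟨0, hM0⟩), by simp [hT, hg]⟩
  obtain ⟨𝓛, hL, hcov, hcard⟩ := h.exists_isPathSystem (by exact_mod_cast hdr) hd hTne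
  have hcov' : covered 𝓛 = Finset.univ.filter fun v => ¬ (c v).1 ∈ X := by
    rw [hcov]; ext v; simp [hT]
  refine ⟨𝓛, hL, ?_, ?_, ?_⟩
  · intro v hv
    rw [hcov'] at hv
    exact (Finset.mem_filter.1 hv).2
  · have e1 := h.card_le_div_cube hm hm0 hmd
    rw [Fintype.card_prod, Fintype.card_fin, Fintype.card_fin, Nat.cast_mul, ← hm] at hcard
    rw [← hn] at hcard e1 ⊢
    have e2 : (m + 2) * B.card ≤ 3 * m * (n / m ^ 3) := by
      gcongr
      linarith only [hm2]
    have e3 : 3 * m * (n / m ^ 3) = 3 * (n / m ^ 2) := by field_simp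
    have e4 : n / m ^ 2 ≤ n / m := by
      gcongr
      exact le_self_pow₀ (by linarith only [hm2]) two_ne_zero
    have e5 : 7 * (1 / m) ^ 1 * n = 7 * (n / m) := by ring
    linarith only [hcard, e2, e3, e4, e5]
  · have e1 := Finset.card_filter_add_card_filter_not (s := (Finset.univ : Finset V))
      (fun v => (c v).1 ∈ X)
    rw [← hcov', Finset.card_univ] at e1
    have e3 : ((Finset.univ.filter fun v => (c v).1 ∈ X).card : ℝ) + (covered 𝓛).card = n := by
      rw [hn]; exact_mod_cast e1
    have e4 := h.card_groups_le hm hm0 hmd hd X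
    rw [← hn] at e4 ⊢
    have e6 : (X.card : ℝ) * (n / q) * (1 + 2 / m) ≤ X.card * (n / q) * 2 := by
      refine mul_le_mul_of_nonneg_left ?_ (by positivity)
      have : 2 / m ≤ 1 := by rw [div_le_one hm0]; exact hm2
      linarith only [this]
    have e7 : (X.card : ℝ) * (n / q) * 2 = 2 * X.card / q * n := by ring
    linarith only [e3, e4, e6, e7]

/-- A round of merging, with the number of paths measured in powers of `1 / m`. -/
theorem IsEquitable.exists_round_pow (h : IsEquitable G d c B) (hm : m = q * M)
    (hm1 : 1 ≤ m) (hmd : m ^ 7 ≤ d) (hd : G.IsRegularOfDegree d) {γ C : ℝ} (hγ : 0 < γ)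
    (hγ4 : γ ≤ 1 / 4) (hγm : 4 ≤ γ * m) (hC : 0 < C) (hCm : 2 * C ≤ γ * m) {a k : ℕ}
    (ha : 1 ≤ a) (hk3 : k ≤ 3) (hka : k ≤ a) (hak : a + k ≤ 7)
    {𝓛 : Finset (List V)} (h𝓛 : IsPathSystem G 𝓛)
    (hcard : (𝓛.card : ℝ) ≤ C * (1 / m) ^ a * Fintype.card V) {X : Finset (Fin q)} {g : Fin q}
    (hg : g ∉ X) (hcov : ∀ v ∈ covered 𝓛, (c v).1 ∉ insert g X) :
    ∃ 𝓜, IsPathSystem G 𝓜 ∧ (∀ v ∈ covered 𝓜, (c v).1 ∉ X) ∧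
      ((covered 𝓛).card : ℝ) ≤ (covered 𝓜).card + γ * Fintype.card V ∧
      (𝓜.card : ℝ) ≤ ((1 + 4 * γ) / d + 4 * q / γ ^ 2 * (C * (1 / m) ^ a) *
        (m ^ 4 / d + C * (1 / m) ^ a)) * Fintype.card V ∧
      (𝓜.card : ℝ) ≤
        (2 + 4 * q / γ ^ 2 * C * (1 + C)) * (1 / m) ^ (a + k) * Fintype.card V := by
  have hm0 : 0 < m := by linarith
  have hdr : (0 : ℝ) < d := lt_of_lt_of_le (by positivity) hmd
  obtain ⟨x, hx⟩ : ∃ x, x = 1 / m := ⟨_, rfl⟩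
  have hx0 : 0 < x := by rw [hx]; positivity
  have hx1 : x ≤ 1 := by rw [hx, div_le_one hm0]; exact hm1
  have hmx : m * x = 1 := by rw [hx]; field_simp
  rw [← hx] at hcard ⊢
  have hdx : 1 / d ≤ x ^ 7 := by
    rw [hx, one_div_pow]
    exact one_div_le_one_div_of_le (by positivity) hmd
  have he : m ^ 4 / d ≤ x ^ 3 := by
    calc m ^ 4 / d = m ^ 4 * (1 / d) := by ring
      _ ≤ m ^ 4 * x ^ 7 := by gcongr
      _ = (m * x) ^ 4 * x ^ 3 := by ring
      _ = x ^ 3 := by rw [hmx]; ring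
  have hsmall : 2 * (C * x ^ a) ≤ γ := by
    calc 2 * (C * x ^ a) = 2 * C * x ^ a := by ring
      _ ≤ γ * m * x ^ 1 := by
        have : x ^ a ≤ x ^ 1 := pow_le_pow_of_le_one hx0.le hx1 ha
        gcongr
      _ = γ := by rw [pow_one, mul_assoc, hmx, mul_one]
  obtain ⟨𝓜, h1, h2, h3, h4⟩ := h.exists_round hm hm0 hmd hd hγ hγ4 hγm
    (P := C * x ^ a) (by positivity) hsmall h𝓛 hcard hg hcov
  refine ⟨𝓜, h1, h2, h3, h4, h4.trans (mul_le_mul_of_nonneg_right ?_ (by positivity))⟩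
  refine le_trans ?_ (quadratic_recursion_le hx0.le hx1 (by positivity) hC.le hk3 hka hak)
  have e1 : (1 + 4 * γ) / d ≤ 2 * x ^ 7 := by
    calc (1 + 4 * γ) / d = (1 + 4 * γ) * (1 / d) := by ring
      _ ≤ 2 * x ^ 7 := by
        gcongr
        linarith only [hγ4]
  gcongr

/-- Starting from `O(n / m)` paths that avoid the reserved colour groups, four rounds of merging
bring the number of paths down to about `n / d`: the successive bounds are of order `n / m`,
`n / m ^ 2`, `n / m ^ 4`, `n / m ^ 7`, and in the last round the quadratic error is negligible
against `n / d`, as `d` has order `m ^ 7`. -/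
theorem exists_forall_isPathSystem_card_le (q : ℕ) {γ : ℝ} (hγ : 0 < γ) (hγ4 : γ ≤ 1 / 4) :
    ∃ Z : ℝ, ∀ {V : Type*} [Fintype V] [DecidableEq V] {G : SimpleGraph V} [DecidableRel G.Adj]
      {d M : ℕ} {c : V → Fin q × Fin M} {B : Finset V} {m : ℝ}, IsEquitable G d c B →
      m = q * M → 2 ≤ m → m ^ 7 ≤ d → (d : ℝ) ≤ 128 * m ^ 7 → G.IsRegularOfDegree d →
      Z ≤ γ * m → ∀ F : Finset (Fin q), F.card + 5 ≤ q →
      ∃ 𝓛, IsPathSystem G 𝓛 ∧ (∀ v ∈ covered 𝓛, (c v).1 ∉ F) ∧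
        (𝓛.card : ℝ) ≤ (1 + 5 * γ) / d * Fintype.card V ∧
        (1 - 2 * (F.card + 4) / q - 4 * γ) * Fintype.card V ≤ (covered 𝓛).card := by
  obtain ⟨A, hA⟩ : ∃ A : ℝ, A = 4 * q / γ ^ 2 := ⟨_, rfl⟩
  obtain ⟨C₁, hC₁⟩ : ∃ C₁ : ℝ, C₁ = 2 + A * 7 * (1 + 7) := ⟨_, rfl⟩
  obtain ⟨C₂, hC₂⟩ : ∃ C₂ : ℝ, C₂ = 2 + A * C₁ * (1 + C₁) := ⟨_, rfl⟩
  obtain ⟨C₃, hC₃⟩ : ∃ C₃ : ℝ, C₃ = 2 + A * C₂ * (1 + C₂) := ⟨_, rfl⟩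
  have hA0 : 0 ≤ A := by rw [hA]; positivity
  have hC₁0 : 0 < C₁ := by rw [hC₁]; positivity
  have hC₂0 : 0 < C₂ := by rw [hC₂]; positivity
  have hC₃0 : 0 < C₃ := by rw [hC₃]; positivity
  have hE0 : 0 ≤ 128 * (A * C₃ * (1 + C₃)) := by positivity
  refine ⟨14 + 2 * C₁ + 2 * C₂ + 2 * C₃ + 128 * (A * C₃ * (1 + C₃)), ?_⟩
  intro V _ _ G _ d M c B m h hm hm2 hmd hdm hd hZ F hF
  have h0 : 14 ≤ γ * m := by linarith only [hZ, hC₁0, hC₂0, hC₃0, hE0]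
  have h1 : 2 * C₁ ≤ γ * m := by linarith only [hZ, hC₁0, hC₂0, hC₃0, hE0]
  have h2 : 2 * C₂ ≤ γ * m := by linarith only [hZ, hC₁0, hC₂0, hC₃0, hE0]
  have h3 : 2 * C₃ ≤ γ * m := by linarith only [hZ, hC₁0, hC₂0, hC₃0, hE0]
  have h4 : 128 * (A * C₃ * (1 + C₃)) ≤ γ * m := by
    linarith only [hZ, hC₁0, hC₂0, hC₃0, hE0]
  have hγm : 4 ≤ γ * m := by linarith only [h0]
  have hm0 : 0 < m := by linarith only [hm2]
  have hm1 : 1 ≤ m := by linarith only [hm2]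
  have hdr : (0 : ℝ) < d := lt_of_lt_of_le (by positivity) hmd
  obtain ⟨g₁, hg₁⟩ := exists_notMem_of_card_lt F (by omega)
  have c₁ := Finset.card_insert_of_notMem hg₁
  obtain ⟨g₂, hg₂⟩ := exists_notMem_of_card_lt (insert g₁ F) (by omega)
  have c₂ := Finset.card_insert_of_notMem hg₂
  obtain ⟨g₃, hg₃⟩ := exists_notMem_of_card_lt (insert g₂ (insert g₁ F)) (by omega)
  have c₃ := Finset.card_insert_of_notMem hg₃
  obtain ⟨g₄, hg₄⟩ := exists_notMem_of_card_lt (insert g₃ (insert g₂ (insert g₁ F))) (by omega)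
  have c₄ := Finset.card_insert_of_notMem hg₄
  obtain ⟨𝓛₀, hL₀, hcov₀, hcard₀, hlen₀⟩ := h.exists_isPathSystem_groups hm hm2 hmd hd
    (insert g₄ (insert g₃ (insert g₂ (insert g₁ F)))) (by omega)
  obtain ⟨𝓛₁, hL₁, hcov₁, hlen₁, -, hcard₁⟩ := h.exists_round_pow (k := 1) hm hm1 hmd hd hγ hγ4 hγm
    (by norm_num) (by linarith only [h0]) le_rfl (by norm_num) le_rfl (by norm_num) hL₀ hcard₀
    hg₄ hcov₀
  rw [← hA, ← hC₁] at hcard₁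
  obtain ⟨𝓛₂, hL₂, hcov₂, hlen₂, -, hcard₂⟩ := h.exists_round_pow (k := 2) hm hm1 hmd hd hγ hγ4 hγm
    hC₁0 h1 (by norm_num) (by norm_num) le_rfl (by norm_num) hL₁ hcard₁ hg₃ hcov₁
  rw [← hA, ← hC₂] at hcard₂
  obtain ⟨𝓛₃, hL₃, hcov₃, hlen₃, -, hcard₃⟩ := h.exists_round_pow (k := 3) hm hm1 hmd hd hγ hγ4 hγm
    hC₂0 h2 (by norm_num) le_rfl (by norm_num) (by norm_num) hL₂ hcard₂ hg₂ hcov₂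
  rw [← hA, ← hC₃] at hcard₃
  obtain ⟨𝓛₄, hL₄, hcov₄, hlen₄, hcard₄, -⟩ := h.exists_round_pow (k := 0) hm hm1 hmd hd hγ hγ4 hγm
    hC₃0 h3 (by norm_num) (by norm_num) (by norm_num) (by norm_num) hL₃ hcard₃ hg₁ hcov₃
  refine ⟨𝓛₄, hL₄, hcov₄, hcard₄.trans (mul_le_mul_of_nonneg_right ?_ (by positivity)), ?_⟩
  · rw [← hA]
    obtain ⟨x, hx⟩ : ∃ x, x = 1 / m := ⟨_, rfl⟩
    have hx0 : 0 < x := by rw [hx]; positivity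
    have hx1 : x ≤ 1 := by rw [hx, div_le_one hm0]; exact hm1
    have hmx : m * x = 1 := by rw [hx]; field_simp
    rw [← hx]
    have hdx : 1 / d ≤ x ^ 7 := by
      rw [hx, one_div_pow]
      exact one_div_le_one_div_of_le (by positivity) hmd
    have hxd : x ^ 7 ≤ 128 * (1 / d) := by
      rw [mul_one_div, hx, one_div_pow, div_le_div_iff₀ (by positivity) hdr]
      linarith only [hdm]
    have he : m ^ 4 / d ≤ x ^ 3 := by
      calc m ^ 4 / d = m ^ 4 * (1 / d) := by ring
        _ ≤ m ^ 4 * x ^ 7 := by gcongr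
        _ = (m * x) ^ 4 * x ^ 3 := by ring
        _ = x ^ 3 := by rw [hmx]; ring
    have e1 : m ^ 4 / d + C₃ * x ^ 7 ≤ (1 + C₃) * x := by
      have e2 : x ^ 3 ≤ x := pow_le_of_le_one hx0.le hx1 (by norm_num)
      have e3 : C₃ * x ^ 7 ≤ C₃ * x :=
        mul_le_mul_of_nonneg_left (pow_le_of_le_one hx0.le hx1 (by norm_num)) hC₃0.le
      linarith only [e2, e3, he]
    have e4 : A * (C₃ * x ^ 7) * (m ^ 4 / d + C₃ * x ^ 7) ≤ γ * (1 / d) := by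
      calc A * (C₃ * x ^ 7) * (m ^ 4 / d + C₃ * x ^ 7)
          ≤ A * (C₃ * (128 * (1 / d))) * ((1 + C₃) * x) := by gcongr
        _ = 128 * (A * C₃ * (1 + C₃)) * (x * (1 / d)) := by ring
        _ ≤ γ * m * (x * (1 / d)) := by gcongr
        _ = γ * (1 / d) := by rw [← mul_assoc, mul_assoc γ, hmx, mul_one]
    have e5 : (1 + 5 * γ) / d = (1 + 4 * γ) / d + γ * (1 / d) := by ring
    linarith only [e4, e5]
  · have e5 : ((insert g₄ (insert g₃ (insert g₂ (insert g₁ F)))).card : ℝ) = F.card + 4 := by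
      have : (insert g₄ (insert g₃ (insert g₂ (insert g₁ F)))).card = F.card + 4 := by omega
      exact_mod_cast this
    rw [e5] at hlen₀
    linarith only [hlen₀, hlen₁, hlen₂, hlen₃, hlen₄]

end Reserve

/-- The largest `M` with `(q * M) ^ 7 ≤ d` is within a factor of two of equality. -/
theorem exists_scale {q N d : ℕ} (hq : 0 < q) (hN : 1 ≤ N) (hd : (q * N) ^ 7 ≤ d) :
    ∃ M, N ≤ M ∧ (q * M) ^ 7 ≤ d ∧ d ≤ 128 * (q * M) ^ 7 := by
  classical
  have hex : ∃ k, d < (q * (k + 1)) ^ 7 := by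
    refine ⟨d, ?_⟩
    calc d < d + 1 := Nat.lt_succ_self d
      _ ≤ q * (d + 1) := Nat.le_mul_of_pos_left _ hq
      _ ≤ (q * (d + 1)) ^ 7 := Nat.le_self_pow (by norm_num) _
  obtain ⟨M, hMlt, hmin⟩ : ∃ M, d < (q * (M + 1)) ^ 7 ∧ ∀ k < M, ¬ d < (q * (k + 1)) ^ 7 :=
    ⟨Nat.find hex, Nat.find_spec hex, fun k hk => Nat.find_min hex hk⟩
  have hNM : N ≤ M := by
    by_contra hcon
    have h1 : (q * (M + 1)) ^ 7 ≤ (q * N) ^ 7 := by gcongr; omega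
    exact absurd (hd.trans_lt hMlt) (not_lt.2 h1)
  refine ⟨M, hNM, ?_, ?_⟩
  · have h1 := hmin (M - 1) (by omega)
    rwa [show M - 1 + 1 = M by omega, not_lt] at h1
  · calc d ≤ (q * (M + 1)) ^ 7 := hMlt.le
      _ ≤ (q * (2 * M)) ^ 7 := by gcongr; omega
      _ = _ := by ring

/-- The vertices of a regular graph can be split into `q` groups, each of them a faithful sample of
the graph, such that for any three groups about `n / d` paths that leave these three untouched
cover almost all vertices.  The precision `δ'` of the sampling may be chosen after `q`. -/
theorem exists_groups_and_isPathSystem {δ : ℝ} (hδ : 0 < δ) (hδ1 : δ ≤ 1) :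
    ∃ q : ℕ, 0 < q ∧ ∀ δ' : ℝ, 0 < δ' → ∃ d₀ : ℕ, ∀ d : ℕ, d₀ ≤ d →
      ∀ (V : Type*) [Fintype V] [DecidableEq V] (G : SimpleGraph V) [DecidableRel G.Adj],
        G.IsRegularOfDegree d → ∃ (g : V → Fin q) (B : Finset V),
          (B.card : ℝ) ≤ δ' * Fintype.card V ∧
          (∀ F : Finset (Fin q), ∀ v ∉ B, F.card * (d / q : ℝ) * (1 - δ') ≤
            ((G.neighborFinset v ∩ Finset.univ.filter fun u => g u ∈ F).card : ℝ)) ∧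
          (∀ F : Finset (Fin q), ((Finset.univ.filter fun v => g v ∈ F).card : ℝ) ≤
            F.card * (Fintype.card V / q : ℝ) * (1 + δ')) ∧
          ∀ F : Finset (Fin q), F.card ≤ 3 → ∃ 𝓛, IsPathSystem G 𝓛 ∧
            (∀ v ∈ covered 𝓛, g v ∉ F) ∧ (𝓛.card : ℝ) ≤ (1 + δ) / d * Fintype.card V ∧
            (1 - δ) * Fintype.card V ≤ ((covered 𝓛).card : ℝ) := by
  obtain ⟨q, hq⟩ := exists_nat_ge (28 / δ)
  have hqδ : 28 ≤ q * δ := by rwa [div_le_iff₀ hδ] at hq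
  have hq28 : 28 ≤ q := by
    have : (28 : ℝ) ≤ q := by nlinarith [(Nat.cast_nonneg q : (0 : ℝ) ≤ q)]
    exact_mod_cast this
  have hq0 : (0 : ℝ) < q := by exact_mod_cast (by omega : 0 < q)
  have hq1 : (1 : ℝ) ≤ q := by exact_mod_cast (by omega : 1 ≤ q)
  refine ⟨q, by omega, fun δ' hδ' => ?_⟩
  have hγ : 0 < δ / 10 := by positivity
  obtain ⟨Z, hZ⟩ := exists_forall_isPathSystem_card_le q hγ (by linarith)
  obtain ⟨N, hN⟩ := exists_nat_ge (|Z / (δ / 10)| + 2 / δ' + 2)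
  have hZ0 := abs_nonneg (Z / (δ / 10))
  have hδ2 : 0 ≤ 2 / δ' := by positivity
  have hN1 : 1 ≤ N := by
    have : (1 : ℝ) ≤ N := by linarith only [hN, hZ0, hδ2]
    exact_mod_cast this
  refine ⟨(q * N) ^ 7, fun d hd₀ V _ _ G _ hd => ?_⟩
  obtain ⟨M, hNM, hMd, hdM⟩ := exists_scale (by omega) hN1 hd₀
  obtain ⟨m, hm⟩ : ∃ m : ℝ, m = q * M := ⟨_, rfl⟩
  have hNr : (N : ℝ) ≤ M := by exact_mod_cast hNM
  have hmN : |Z / (δ / 10)| + 2 / δ' + 2 ≤ m := by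
    have : (M : ℝ) ≤ m := by rw [hm]; nlinarith [(Nat.cast_nonneg M : (0 : ℝ) ≤ M)]
    linarith only [this, hN, hNr]
  have hm2 : 2 ≤ m := by linarith only [hmN, hZ0, hδ2]
  have hm0 : 0 < m := by linarith only [hm2]
  have hmZ : Z ≤ δ / 10 * m := by
    have : Z / (δ / 10) ≤ m := by
      linarith only [hmN, hZ0, hδ2, le_abs_self (Z / (δ / 10))]
    rw [div_le_iff₀ hγ] at this
    linarith only [this]
  have hmδ : 2 / m ≤ δ' := by
    have : 2 / δ' ≤ m := by linarith only [hmN, hZ0]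
    rw [div_le_iff₀ hδ'] at this
    rw [div_le_iff₀ hm0]
    linarith only [this]
  have hmd : m ^ 7 ≤ d := by rw [hm]; exact_mod_cast hMd
  have hdm : (d : ℝ) ≤ 128 * m ^ 7 := by rw [hm]; exact_mod_cast hdM
  have hdr : (0 : ℝ) < d := lt_of_lt_of_le (by positivity) hmd
  have : Nonempty (Fin q × Fin M) := ⟨(⟨0, by omega⟩, ⟨0, by omega⟩)⟩
  obtain ⟨c, B, h⟩ := exists_isEquitable G (by exact_mod_cast hdr) hd (Fin q × Fin M)
  refine ⟨fun v => (c v).1, B, ?_, ?_, ?_, ?_⟩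
  · refine (h.card_le_div_cube hm hm0 hmd).trans ?_
    have h1 : 1 / m ^ 3 ≤ δ' := by
      refine le_trans ?_ hmδ
      rw [div_le_div_iff₀ (by positivity) hm0]
      have : m ≤ m ^ 3 := le_self_pow₀ (by linarith only [hm2]) (by norm_num)
      linarith only [this, hm0]
    calc (Fintype.card V : ℝ) / m ^ 3 = 1 / m ^ 3 * Fintype.card V := by ring
      _ ≤ δ' * Fintype.card V := by gcongr
  · intro F v hv
    refine le_trans ?_ (h.le_card_inter_groups hm hm0 F hv)
    refine mul_le_mul_of_nonneg_left ?_ (by positivity)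
    have e1 : 2 / m = 2 * (1 / m) := by ring
    have e2 : 0 < 1 / m := by positivity
    linarith only [e1, e2, hmδ]
  · intro F
    refine (h.card_groups_le hm hm0 hmd hd F).trans ?_
    exact mul_le_mul_of_nonneg_left (by linarith only [hmδ]) (by positivity)
  · intro F hF
    obtain ⟨𝓛, h1, h2, h3, h4⟩ := hZ h hm hm2 hmd hdm hd hmZ F (by omega)
    refine ⟨𝓛, h1, h2, h3.trans ?_, le_trans ?_ h4⟩
    · gcongr
      linarith only [hδ]
    · refine mul_le_mul_of_nonneg_right ?_ (by positivity)
      have h5 : 2 * ((F.card : ℝ) + 4) / q ≤ δ / 2 := by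
        have : (F.card : ℝ) ≤ 3 := by exact_mod_cast hF
        rw [div_le_div_iff₀ hq0 (by norm_num)]
        linarith only [this, hqδ]
      linarith only [h5, hδ]

/-! ### Induced cherries and the connectivity of the reserve -/

section Cherry

variable {V : Type*} {G : SimpleGraph V}

/-- The edges of `G` inside `R`, as a graph on all vertices. -/
def edgesWithin (G : SimpleGraph V) (R : Finset V) : SimpleGraph V where
  Adj u v := G.Adj u v ∧ u ∈ R ∧ v ∈ R
  symm := ⟨fun _ _ h => ⟨h.1.symm, h.2.2, h.2.1⟩⟩
  loopless := ⟨fun _ h => h.1.ne rfl⟩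

theorem exists_connector_of_reachable {R : Finset V} {x x' y y' : V} (hy : y ∈ R)
    (hxy : G.Adj x y) (hyx' : G.Adj y' x') (h : (edgesWithin G R).Reachable y y') :
    ∃ w : List V, w.Nodup ∧ (∀ v ∈ w, v ∈ R) ∧ (x :: (w ++ [x'])).IsChain G.Adj := by
  obtain ⟨p, hp⟩ := h.exists_isPath
  refine ⟨p.support, hp.support_nodup, ?_, ?_⟩
  · clear hp hyx' hxy
    induction p with
    | nil => simpa using hy
    | cons hadj p ih =>
      intro v hv
      rcases List.mem_cons.1 (SimpleGraph.Walk.support_cons hadj p ▸ hv) with rfl | hv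
      · exact hy
      · exact ih hadj.2.2 ⟨p⟩ v hv
  · rw [List.isChain_cons, List.isChain_append]
    refine ⟨?_, p.isChain_adj_support.imp fun _ _ hab => hab.1, by simp, ?_⟩
    · intro z hz
      rw [← p.cons_tail_support] at hz
      simp only [List.cons_append, List.head?_cons, Option.mem_def, Option.some.injEq] at hz
      exact hz ▸ hxy
    · intro z hz z' hz'
      rw [List.getLast?_eq_some_getLast p.support_ne_nil, p.getLast_support] at hz
      simp only [List.head?_cons, Option.mem_def, Option.some.injEq] at hz hz'
      exact hz ▸ hz' ▸ hyx'

variable [Fintype V] [DecidableEq V] [DecidableRel G.Adj]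

/-- The induced paths on three vertices of `S`, as triples with the centre in the middle; each is
counted in both directions.  In a disjoint union of cliques there are none. -/
def inducedCherries (G : SimpleGraph V) [DecidableRel G.Adj] (S : Finset V) :
    Finset (V × V × V) :=
  Finset.univ.filter fun t => (t.1 ∈ S ∧ t.2.1 ∈ S ∧ t.2.2 ∈ S) ∧
    G.Adj t.1 t.2.1 ∧ G.Adj t.2.1 t.2.2 ∧ t.1 ≠ t.2.2 ∧ ¬ G.Adj t.1 t.2.2

theorem card_filter_inducedCherries_fst_le {d : ℕ} (hd : ∀ v, G.degree v ≤ d) (S : Finset V)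
    (a : V) : ((inducedCherries G S).filter fun t => t.1 = a).card ≤ d * d := by
  calc ((inducedCherries G S).filter fun t => t.1 = a).card
      ≤ ((G.neighborFinset a).sigma fun y => G.neighborFinset y).card := by
        refine Finset.card_le_card_of_injOn (fun t => ⟨t.2.1, t.2.2⟩) ?_ ?_
        · intro t ht
          obtain ⟨ht, hta⟩ := Finset.mem_filter.1 (Finset.mem_coe.1 ht)
          obtain ⟨-, -, h1, h2, -⟩ := Finset.mem_filter.1 ht
          simp [← hta, h1, h2]
        · rintro ⟨a₁, y₁, b₁⟩ h₁ ⟨a₂, y₂, b₂⟩ h₂ heq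
          have e₁ : a₁ = a := (Finset.mem_filter.1 (Finset.mem_coe.1 h₁)).2
          have e₂ : a₂ = a := (Finset.mem_filter.1 (Finset.mem_coe.1 h₂)).2
          simp_all
    _ ≤ d * d := by
        rw [Finset.card_sigma, ← smul_eq_mul]
        refine (Finset.sum_le_card_nsmul _ _ d fun y _ => ?_).trans
          (Nat.mul_le_mul_right d ?_)
        · rw [G.card_neighborFinset_eq_degree]; exact hd y
        · rw [G.card_neighborFinset_eq_degree]; exact hd a

/-- Two of at least two paths can be joined through the reserve `R`, unless the graph induced on `R`
contains few induced cherries.  Take on each path a typical vertex near its start.  If no two of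
these are connected through `R`, then the parts of `R` that they reach are disjoint, and as each has
at least `Dr` vertices while `|R|` is only slightly larger than `|𝓛| * Dr`, each has about `Dr`
vertices.  Since degrees into `R` are at least `Dr` too, every part is almost a clique. -/
theorem IsPathSystem.exists_link_or_card_inducedCherries_le {𝓛 : Finset (List V)} {d : ℕ}
    (hd : ∀ v, G.degree v ≤ d) (h : IsPathSystem G 𝓛) {R B : Finset V} {s : ℕ} {Dr ρ : ℝ}
    (hne : 𝓛.Nonempty) (hBs : B.card < s) (hρ : 0 ≤ ρ) (hR : ∀ v ∈ covered 𝓛, v ∉ R)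
    (hgood : ∀ v ∉ B, Dr ≤ ((G.neighborFinset v ∩ R).card : ℝ))
    (hRcard : (R.card : ℝ) ≤ 𝓛.card * Dr + ρ) :
    (∃ 𝓜, IsPathSystem G 𝓜 ∧ 𝓜.card + 1 = 𝓛.card ∧
      (covered 𝓛).card ≤ (covered 𝓜).card + 2 * s) ∨
    ((inducedCherries G R).card : ℝ) ≤ R.card * (d * ρ) + (ρ + B.card) * (d * d) := by
  classical
  by_cases hshort : ∃ l ∈ 𝓛, l.length < s
  · obtain ⟨l, hl, hls⟩ := hshort
    refine Or.inl ⟨𝓛.erase l, h.mono (Finset.erase_subset l 𝓛), Finset.card_erase_add_one hl, ?_⟩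
    have := h.card_covered_erase hl
    omega
  push Not at hshort
  have hex : ∀ l ∈ 𝓛, ∃ x ∈ l.take s, x ∉ B := by
    intro l hl
    by_contra hno
    push Not at hno
    have h1 := (h.mono (Finset.singleton_subset_iff.2 hl)).card_mul_le_of_take_subset
      (s := s) (B := B) (by simpa using hshort l hl) (by simpa using hno)
    rw [Finset.card_singleton, one_mul] at h1
    omega
  have : ∀ l, ∃ x, l ∈ 𝓛 → x ∈ l.take s ∧ x ∉ B := by
    intro l
    by_cases hl : l ∈ 𝓛
    · obtain ⟨x, hx⟩ := hex l hl
      exact ⟨x, fun _ => hx⟩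
    · obtain ⟨l', hl'⟩ := hne
      obtain ⟨x, -⟩ := hex l' hl'
      exact ⟨x, fun hh => absurd hh hl⟩
  choose x hx using this
  set D : List V → Finset V := fun l => R.filter fun u =>
    ∃ y ∈ R, G.Adj (x l) y ∧ (edgesWithin G R).Reachable y u with hD
  by_cases hlink : ∃ l ∈ 𝓛, ∃ m ∈ 𝓛, l ≠ m ∧ ¬ Disjoint (D l) (D m)
  · left
    obtain ⟨l, hl, m, hm, hlm, hnd⟩ := hlink
    obtain ⟨u, hu, hu'⟩ := Finset.not_disjoint_iff.1 hnd
    obtain ⟨-, y, hy, hxy, hyu⟩ := Finset.mem_filter.1 hu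
    obtain ⟨-, y', -, hxy', hyu'⟩ := Finset.mem_filter.1 hu'
    obtain ⟨w, hw, hwR, hwc⟩ :=
      exists_connector_of_reachable hy hxy hxy'.symm (hyu.trans hyu'.symm)
    obtain ⟨l₁, l₂, hleq, hl₁⟩ := List.exists_eq_append_cons_of_mem_take (hx l hl).1
    obtain ⟨m₁, m₂, hmeq, hm₁⟩ := List.exists_eq_append_cons_of_mem_take (hx m hm).1
    obtain ⟨𝓜, hM, hcard, -, hlen⟩ := h.join (w := w) (hleq ▸ hl) (hmeq ▸ hm)
      (fun e => hlm (hleq.trans (e.trans hmeq.symm))) hw hwc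
      (fun v hv hv' => hR v hv' (hwR v hv))
    exact ⟨𝓜, hM, hcard, by omega⟩
  right
  push Not at hlink
  have hDR : ∀ l, D l ⊆ R := fun l => Finset.filter_subset _ _
  have hDge : ∀ l ∈ 𝓛, Dr ≤ ((D l).card : ℝ) := by
    intro l hl
    refine (hgood _ (hx l hl).2).trans ?_
    refine Nat.cast_le.2 (Finset.card_le_card fun u hu => ?_)
    rw [Finset.mem_inter, SimpleGraph.mem_neighborFinset] at hu
    exact Finset.mem_filter.2 ⟨hu.2, u, hu.2, hu.1, SimpleGraph.Reachable.refl u⟩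
  have hsum : (𝓛.biUnion D).card = ∑ l ∈ 𝓛, (D l).card :=
    Finset.card_biUnion fun l hl m hm hlm => hlink l hl m hm hlm
  have hUR : 𝓛.biUnion D ⊆ R := Finset.biUnion_subset.2 fun l _ => hDR l
  have hUge : (𝓛.card : ℝ) * Dr ≤ ((𝓛.biUnion D).card : ℝ) := by
    rw [hsum, Nat.cast_sum, ← nsmul_eq_mul]
    exact Finset.card_nsmul_le_sum 𝓛 _ _ hDge
  have hDle : ∀ l ∈ 𝓛, ((D l).card : ℝ) ≤ Dr + ρ := by
    intro l hl
    have h1 : ((𝓛.erase l).card : ℝ) * Dr ≤ ∑ m ∈ 𝓛.erase l, ((D m).card : ℝ) := by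
      rw [← nsmul_eq_mul]
      exact Finset.card_nsmul_le_sum _ _ _ fun m hm => hDge m (Finset.mem_of_mem_erase hm)
    have h2 : ∑ m ∈ 𝓛.erase l, ((D m).card : ℝ) + (D l).card = ((𝓛.biUnion D).card : ℝ) := by
      rw [hsum, Nat.cast_sum, Finset.sum_erase_add _ _ hl]
    have h3 : ((𝓛.biUnion D).card : ℝ) ≤ R.card := by exact_mod_cast Finset.card_le_card hUR
    have h4 : ((𝓛.erase l).card : ℝ) + 1 = 𝓛.card := by
      exact_mod_cast Finset.card_erase_add_one hl
    rw [← h4] at hRcard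
    linarith
  -- a typical vertex of a part is adjacent to all but `ρ` of the part, which contains all its
  -- neighbours in `R` and all of theirs
  have hfibre : ∀ a ∈ 𝓛.biUnion D \ B,
      (((inducedCherries G R).filter fun t => t.1 = a).card : ℝ) ≤ d * ρ := by
    intro a ha
    obtain ⟨ha, haB⟩ := Finset.mem_sdiff.1 ha
    obtain ⟨l, hl, hal⟩ := Finset.mem_biUnion.1 ha
    obtain ⟨haR, y₀, hy₀, hxy₀, hy₀a⟩ := Finset.mem_filter.1 hal
    have hcl : ∀ u v, G.Adj u v → u ∈ D l → v ∈ R → v ∈ D l := by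
      intro u v huv hu hv
      obtain ⟨huR, z, hz, hxz, hzu⟩ := Finset.mem_filter.1 hu
      have : (edgesWithin G R).Adj u v := ⟨huv, huR, hv⟩
      exact Finset.mem_filter.2 ⟨hv, z, hz, hxz, hzu.trans this.reachable⟩
    have hNa : G.neighborFinset a ∩ R ⊆ D l := by
      intro u hu
      rw [Finset.mem_inter, SimpleGraph.mem_neighborFinset] at hu
      exact hcl a u hu.1 hal hu.2
    have h1 : ((inducedCherries G R).filter fun t => t.1 = a).card ≤
        (G.neighborFinset a ×ˢ (D l \ (G.neighborFinset a ∩ R))).card := by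
      refine Finset.card_le_card_of_injOn (fun t => t.2) ?_ ?_
      · rintro ⟨a', y, b⟩ ht
        obtain ⟨ht, hta⟩ := Finset.mem_filter.1 (Finset.mem_coe.1 ht)
        obtain ⟨-, ⟨-, hyR, hbR⟩, h1, h2, -, h4⟩ := Finset.mem_filter.1 ht
        simp only at hta hyR hbR h1 h2 h4
        subst hta
        simp only [Finset.coe_product, Set.mem_prod, Finset.mem_coe, Finset.mem_sdiff,
          Finset.mem_inter, SimpleGraph.mem_neighborFinset]
        exact ⟨h1, hcl y b h2 (hcl _ y h1 hal hyR) hbR, fun hh => h4 hh.1⟩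
      · rintro ⟨a₁, t₁⟩ h₁ ⟨a₂, t₂⟩ h₂ heq
        have e₁ : a₁ = a := (Finset.mem_filter.1 (Finset.mem_coe.1 h₁)).2
        have e₂ : a₂ = a := (Finset.mem_filter.1 (Finset.mem_coe.1 h₂)).2
        simp_all
    rw [Finset.card_product, G.card_neighborFinset_eq_degree] at h1
    have h2 : ((D l \ (G.neighborFinset a ∩ R)).card : ℝ) ≤ ρ := by
      have h3 : ((D l \ (G.neighborFinset a ∩ R)).card : ℝ) + (G.neighborFinset a ∩ R).card =
          (D l).card := by exact_mod_cast Finset.card_sdiff_add_card_eq_card hNa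
      have h4 := hgood a haB
      have h5 := hDle l hl
      linarith
    calc (((inducedCherries G R).filter fun t => t.1 = a).card : ℝ)
        ≤ G.degree a * (D l \ (G.neighborFinset a ∩ R)).card := by exact_mod_cast h1
      _ ≤ d * ρ := by
        have : (G.degree a : ℝ) ≤ d := by exact_mod_cast hd a
        gcongr
  have htotal : (inducedCherries G R).card =
      ∑ a ∈ R, ((inducedCherries G R).filter fun t => t.1 = a).card := by
    refine Finset.card_eq_sum_card_fiberwise fun t ht => ?_
    exact Finset.mem_coe.2 (Finset.mem_filter.1 (Finset.mem_coe.1 ht)).2.1.1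
  rw [htotal, Nat.cast_sum, ← Finset.sum_sdiff (Finset.sdiff_subset.trans hUR :
    𝓛.biUnion D \ B ⊆ R), add_comm]
  refine add_le_add ?_ ?_
  · refine (Finset.sum_le_card_nsmul _ _ _ hfibre).trans ?_
    rw [nsmul_eq_mul]
    have : ((𝓛.biUnion D \ B).card : ℝ) ≤ R.card := by
      exact_mod_cast Finset.card_le_card (Finset.sdiff_subset.trans hUR)
    gcongr
  · refine (Finset.sum_le_card_nsmul _ _ ((d : ℝ) * d) fun a _ => ?_).trans ?_
    · exact_mod_cast card_filter_inducedCherries_fst_le hd R a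
    · rw [nsmul_eq_mul]
      have h1 : R \ (𝓛.biUnion D \ B) ⊆ (R \ 𝓛.biUnion D) ∪ B := by
        intro v hv
        simp only [Finset.mem_sdiff, Finset.mem_union] at hv ⊢
        tauto
      have h2 : ((R \ (𝓛.biUnion D \ B)).card : ℝ) ≤ (R \ 𝓛.biUnion D).card + B.card := by
        exact_mod_cast (Finset.card_le_card h1).trans (Finset.card_union_le _ _)
      have h3 : ((R \ 𝓛.biUnion D).card : ℝ) + (𝓛.biUnion D).card = R.card := by
        exact_mod_cast Finset.card_sdiff_add_card_eq_card hUR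
      gcongr
      linarith

end Cherry

/-! ### Graphs with few induced cherries -/

section NearClique

variable {V : Type*} {G : SimpleGraph V}

/-- A shortest walk between two different sets of a family meets the family only in its ends. -/
theorem exists_connector_of_reachable_parts {ι : Type*} (I : Set ι) (T : ι → Set V)
    (h : ∃ a ∈ I, ∃ b ∈ I, a ≠ b ∧ ∃ x ∈ T a, ∃ y ∈ T b, G.Reachable x y)
    (hdisj : ∀ a ∈ I, ∀ b ∈ I, a ≠ b → Disjoint (T a) (T b)) :
    ∃ a ∈ I, ∃ b ∈ I, a ≠ b ∧ ∃ x ∈ T a, ∃ y ∈ T b, ∃ w : List V, w.Nodup ∧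
      (x :: (w ++ [y])).IsChain G.Adj ∧ ∀ v ∈ w, ∀ c ∈ I, v ∉ T c := by
  classical
  have hex : ∃ k, ∃ a ∈ I, ∃ b ∈ I, a ≠ b ∧ ∃ x ∈ T a, ∃ y ∈ T b, ∃ p : G.Walk x y,
      p.length = k := by
    obtain ⟨a, ha, b, hb, hab, x, hx, y, hy, ⟨p⟩⟩ := h
    exact ⟨p.length, a, ha, b, hb, hab, x, hx, y, hy, p, rfl⟩
  obtain ⟨a, ha, b, hb, hab, x, hx, y, hy, p, hp⟩ := Nat.find_spec hex
  have hmin : ∀ a' ∈ I, ∀ b' ∈ I, a' ≠ b' → ∀ x' ∈ T a', ∀ y' ∈ T b', ∀ p' : G.Walk x' y',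
      p.length ≤ p'.length := by
    intro a' ha' b' hb' hab' x' hx' y' hy' p'
    rw [hp]
    exact Nat.find_min' hex ⟨a', ha', b', hb', hab', x', hx', y', hy', p', rfl⟩
  have hpath := p.bypass_isPath
  have hlen : p.bypass.length ≤ p.length := p.length_bypass_le_length
  generalize p.bypass = r at hpath hlen
  have hxy : x ≠ y := fun e => Set.disjoint_left.1 (hdisj a ha b hb hab) hx (e ▸ hy)
  cases r with
  | nil => exact absurd rfl hxy
  | @cons _ z _ hadj r' =>
    rw [SimpleGraph.Walk.cons_isPath_iff] at hpath
    obtain ⟨hr', hxr'⟩ := hpath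
    have hsup : r'.support.dropLast ++ [y] = r'.support := by
      conv_rhs => rw [← List.dropLast_append_getLast r'.support_ne_nil, r'.getLast_support]
    have hnd := hr'.support_nodup
    rw [← hsup, List.nodup_append'] at hnd
    refine ⟨a, ha, b, hb, hab, x, hx, y, hy, r'.support.dropLast, hnd.1, ?_, ?_⟩
    · rw [hsup]
      exact r'.isChain_adj_cons_support hadj
    · intro v hv c hc hvc
      have hvr : v ∈ r'.support := List.mem_of_mem_dropLast hv
      have hvy : v ≠ y := fun e => hnd.2.2 hv (by simp [e])
      rw [SimpleGraph.Walk.length_cons] at hlen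
      by_cases hca : c = a
      · subst hca
        have h1 := hmin c hc b hb hab v hvc y hy (r'.dropUntil v hvr)
        have h2 := r'.length_dropUntil_le_length hvr
        omega
      · have h1 := hmin a ha c hc (Ne.symm hca) x hx v hvc
          (SimpleGraph.Walk.cons hadj (r'.takeUntil v hvr))
        have h2 := SimpleGraph.Walk.length_takeUntil_lt_length hvr hvy
        rw [SimpleGraph.Walk.length_cons] at h1
        omega

variable [Fintype V] [DecidableEq V] [DecidableRel G.Adj]

/-- The closed neighbourhood of a vertex. -/
def closedNbhd (G : SimpleGraph V) [DecidableRel G.Adj] (v : V) : Finset V :=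
  insert v (G.neighborFinset v)

theorem mem_closedNbhd {u v : V} : u ∈ closedNbhd G v ↔ u = v ∨ G.Adj v u := by
  simp [closedNbhd]

theorem mem_closedNbhd_comm {u v : V} : u ∈ closedNbhd G v ↔ v ∈ closedNbhd G u := by
  rw [mem_closedNbhd, mem_closedNbhd, eq_comm, G.adj_comm]

theorem card_closedNbhd {d : ℕ} (hd : G.IsRegularOfDegree d) (v : V) :
    (closedNbhd G v).card = d + 1 := by
  rw [closedNbhd, Finset.card_insert_of_notMem (by simp), G.card_neighborFinset_eq_degree, hd v]

/-- Greedy extension: in an almost complete set `T`, a path from any given vertex can be continued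
until fewer vertices of `T` are left than may be missing from a closed neighbourhood. -/
theorem exists_path_of_almost_complete {T : Finset V} {t : ℝ}
    (hT : ∀ u ∈ T, ((T \ closedNbhd G u).card : ℝ) ≤ t) {u₀ : V} (hu₀ : u₀ ∈ T) :
    ∃ l : List V, (u₀ :: l).Nodup ∧ (u₀ :: l).IsChain G.Adj ∧ (∀ v ∈ u₀ :: l, v ∈ T) ∧
      ((T \ (u₀ :: l).toFinset).card : ℝ) ≤ t := by
  -- the path is grown at its head, away from `u₀`, and reversed in the end
  have key : ∀ k : ℕ, ∀ (h : V) (l : List V), (h :: l).getLast (by simp) = u₀ → (h :: l).Nodup →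
      (h :: l).IsChain G.Adj → (∀ v ∈ h :: l, v ∈ T) → (T \ (h :: l).toFinset).card = k →
      ∃ l' : List V, l'.getLast? = some u₀ ∧ l'.Nodup ∧ l'.IsChain G.Adj ∧ (∀ v ∈ l', v ∈ T) ∧
        ((T \ l'.toFinset).card : ℝ) ≤ t := by
    intro k
    induction k with
    | zero =>
      intro h l h1 h2 h3 h4 h5
      refine ⟨h :: l, by rw [List.getLast?_eq_some_getLast (by simp), h1], h2, h3, h4, ?_⟩
      rw [h5, Nat.cast_zero]
      exact (Nat.cast_nonneg _).trans (hT u₀ hu₀)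
    | succ k ih =>
      intro h l h1 h2 h3 h4 h5
      by_cases hle : ((T \ (h :: l).toFinset).card : ℝ) ≤ t
      · exact ⟨h :: l, by rw [List.getLast?_eq_some_getLast (by simp), h1], h2, h3, h4, hle⟩
      have hnot : ¬ T \ (h :: l).toFinset ⊆ T \ closedNbhd G h := by
        intro hsub
        exact hle ((Nat.cast_le.2 (Finset.card_le_card hsub)).trans (hT h (h4 h (by simp))))
      obtain ⟨w, hw, hw'⟩ := Finset.not_subset.1 hnot
      rw [Finset.mem_sdiff, List.mem_toFinset] at hw
      rw [Finset.mem_sdiff, not_and, not_not] at hw'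
      have hadj : G.Adj h w := by
        rcases mem_closedNbhd.1 (hw' hw.1) with rfl | hadj
        · exact absurd (by simp) hw.2
        · exact hadj
      refine ih w (h :: l) ?_ (List.nodup_cons.2 ⟨hw.2, h2⟩)
        (List.isChain_cons_cons.2 ⟨hadj.symm, h3⟩) ?_ ?_
      · rw [List.getLast_cons (by simp), h1]
      · intro v hv
        rcases List.mem_cons.1 hv with rfl | hv
        · exact hw.1
        · exact h4 v hv
      · have : T \ (w :: h :: l).toFinset = (T \ (h :: l).toFinset).erase w := by
          ext v
          rw [List.toFinset_cons, Finset.mem_sdiff, Finset.mem_insert, Finset.mem_erase,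
            Finset.mem_sdiff]
          tauto
        rw [this, Finset.card_erase_of_mem (by rwa [Finset.mem_sdiff, List.mem_toFinset]), h5]
        rfl
  obtain ⟨l', h1, h2, h3, h4, h5⟩ := key _ u₀ [] (by simp) (by simp) (by simp) (by simpa using hu₀)
    rfl
  have hne : l' ≠ [] := by rintro rfl; simp at h1
  have hrev : l'.reverse = u₀ :: l'.reverse.tail := by
    have h6 : l'.reverse.head? = some u₀ := by rw [List.head?_reverse, h1]
    cases hr : l'.reverse with
    | nil => simp [hr] at h6
    | cons a r => simp [hr] at h6; simp [h6]
  refine ⟨l'.reverse.tail, ?_, ?_, ?_, ?_⟩ <;> rw [← hrev]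
  · exact List.nodup_reverse.2 h2
  · rw [List.isChain_reverse]
    exact h3.imp fun _ _ hab => hab.symm
  · simpa using h4
  · simpa using h5

/-- Disjoint almost complete sets are nearly covered by one path each, with prescribed starting
vertices. -/
theorem exists_isPathSystem_of_almost_complete {ι : Type*} [DecidableEq ι] (I : Finset ι)
    (T : ι → Finset V) {t : ℝ} (hT : ∀ i ∈ I, ∀ u ∈ T i, ((T i \ closedNbhd G u).card : ℝ) ≤ t)
    (hdisj : ∀ i ∈ I, ∀ j ∈ I, i ≠ j → Disjoint (T i) (T j)) (st : ι → V)
    (hst : ∀ i ∈ I, st i ∈ T i) :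
    ∃ 𝓛, IsPathSystem G 𝓛 ∧ 𝓛.card = I.card ∧ covered 𝓛 ⊆ I.biUnion T ∧
      (((I.biUnion T) \ covered 𝓛).card : ℝ) ≤ I.card * t ∧
      ∀ i ∈ I, ∃ l, st i :: l ∈ 𝓛 ∧ ∀ v ∈ st i :: l, v ∈ T i := by
  have : ∀ i, ∃ l : List V, i ∈ I → (st i :: l).Nodup ∧ (st i :: l).IsChain G.Adj ∧
      (∀ v ∈ st i :: l, v ∈ T i) ∧ ((T i \ (st i :: l).toFinset).card : ℝ) ≤ t := by
    intro i
    by_cases hi : i ∈ I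
    · obtain ⟨l, hl⟩ := exists_path_of_almost_complete (hT i hi) (hst i hi)
      exact ⟨l, fun _ => hl⟩
    · exact ⟨[], fun h => absurd h hi⟩
  choose L hL using this
  have hne : ∀ i ∈ I, ∀ j ∈ I, i ≠ j → (st i :: L i).Disjoint (st j :: L j) :=
    fun i hi j hj hij v hv hv' =>
      Finset.disjoint_left.1 (hdisj i hi j hj hij) ((hL i hi).2.2.1 v hv) ((hL j hj).2.2.1 v hv')
  refine ⟨I.image fun i => st i :: L i, ⟨?_, ?_, ?_, ?_⟩, ?_, ?_, ?_, ?_⟩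
  · intro l hl
    obtain ⟨i, hi, rfl⟩ := Finset.mem_image.1 hl
    simp
  · intro l hl
    obtain ⟨i, hi, rfl⟩ := Finset.mem_image.1 hl
    exact (hL i hi).1
  · intro l hl
    obtain ⟨i, hi, rfl⟩ := Finset.mem_image.1 hl
    exact (hL i hi).2.1
  · intro l hl m hm hlm
    obtain ⟨i, hi, rfl⟩ := Finset.mem_image.1 hl
    obtain ⟨j, hj, rfl⟩ := Finset.mem_image.1 hm
    exact hne i hi j hj fun e => hlm (by rw [e])
  · refine Finset.card_image_of_injOn fun i hi j hj hij => ?_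
    by_contra hcon
    refine hne i hi j hj hcon (a := st i) (by simp) ?_
    rw [← hij]; simp
  · intro v hv
    obtain ⟨l, hl, hvl⟩ := mem_covered.1 hv
    obtain ⟨i, hi, rfl⟩ := Finset.mem_image.1 hl
    exact Finset.mem_biUnion.2 ⟨i, hi, (hL i hi).2.2.1 v hvl⟩
  · have hsub : (I.biUnion T) \ covered (I.image fun i => st i :: L i) ⊆
        I.biUnion fun i => T i \ (st i :: L i).toFinset := by
      intro v hv
      obtain ⟨hv, hv'⟩ := Finset.mem_sdiff.1 hv
      obtain ⟨i, hi, hvi⟩ := Finset.mem_biUnion.1 hv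
      refine Finset.mem_biUnion.2 ⟨i, hi, Finset.mem_sdiff.2 ⟨hvi, fun hvl => hv' ?_⟩⟩
      exact mem_covered.2 ⟨_, Finset.mem_image_of_mem _ hi, List.mem_toFinset.1 hvl⟩
    have h1 := (Finset.card_le_card hsub).trans Finset.card_biUnion_le
    have h2 : ∑ i ∈ I, ((T i \ (st i :: L i).toFinset).card : ℝ) ≤ I.card * t := by
      rw [← nsmul_eq_mul]
      exact Finset.sum_le_card_nsmul I _ _ fun i hi => (hL i hi).2.2.2
    exact le_trans (by exact_mod_cast h1) h2
  · intro i hi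
    exact ⟨L i, Finset.mem_image_of_mem _ hi, (hL i hi).2.2.1⟩

/-- Disjoint almost complete sets `T i`, each containing its index, in a `d`-regular graph with
fewer than `j (d + 1)` vertices.  If there are at most `j` of them, then fewer than `j` paths
suffice: either two of the sets are connected in `G`, and a shortest connection joins two paths, or
the closed neighbourhoods of the indices are disjoint, which leaves room for fewer than `j`. -/
theorem exists_isPathSystem_card_lt {d j : ℕ} (hd : G.IsRegularOfDegree d)
    (hn : Fintype.card V < j * (d + 1)) (I : Finset V) (T : V → Finset V) {t : ℝ}
    (hT : ∀ i ∈ I, ∀ u ∈ T i, ((T i \ closedNbhd G u).card : ℝ) ≤ t)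
    (hdisj : ∀ i ∈ I, ∀ j ∈ I, i ≠ j → Disjoint (T i) (T j)) (hself : ∀ i ∈ I, i ∈ T i)
    (hI : I.card ≤ j) :
    ∃ 𝓛, IsPathSystem G 𝓛 ∧ 𝓛.card < j ∧
      ((I.biUnion T).card : ℝ) ≤ (covered 𝓛).card + I.card * t := by
  have hcount : ∀ 𝓛 : Finset (List V), (((I.biUnion T) \ covered 𝓛).card : ℝ) ≤ I.card * t →
      ((I.biUnion T).card : ℝ) ≤ (covered 𝓛).card + I.card * t := by
    intro 𝓛 h
    have h1 : (I.biUnion T).card ≤ ((I.biUnion T) \ covered 𝓛).card + (covered 𝓛).card :=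
      Finset.card_le_card_sdiff_add_card
    have h2 : ((I.biUnion T).card : ℝ) ≤ ((I.biUnion T) \ covered 𝓛).card + (covered 𝓛).card := by
      exact_mod_cast h1
    linarith
  by_cases hreach : ∃ a ∈ (I : Set V), ∃ b ∈ (I : Set V), a ≠ b ∧ ∃ x ∈ (T a : Set V),
      ∃ y ∈ (T b : Set V), G.Reachable x y
  · obtain ⟨a, ha, b, hb, hab, x, hx, y, hy, w, hw, hwc, hwT⟩ :=
      exists_connector_of_reachable_parts (I : Set V) (fun i => (T i : Set V)) hreach
        fun i hi j hj hij => Finset.disjoint_coe.2 (hdisj i hi j hj hij)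
    set st : V → V := fun i => if i = a then x else if i = b then y else i with hst
    have hsta : st a = x := by simp [hst]
    have hstb : st b = y := by simp [hst, hab.symm]
    obtain ⟨𝓛, hL, hcard, hcov, hmiss, hhead⟩ :=
      exists_isPathSystem_of_almost_complete I T hT hdisj st (by
        intro i hi
        by_cases hia : i = a
        · subst hia; rw [hsta]; exact hx
        · by_cases hib : i = b
          · subst hib; rw [hstb]; exact hy
          · simpa [hst, hia, hib] using hself i hi)
    obtain ⟨l, hl, hlT⟩ := hhead a ha
    obtain ⟨m, hm, hmT⟩ := hhead b hb
    rw [hsta] at hl hlT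
    rw [hstb] at hm hmT
    have hlm : x :: l ≠ y :: m := by
      intro e
      exact Finset.disjoint_left.1 (hdisj a ha b hb hab) (hlT x (by simp)) (hmT x (by simp [← e]))
    obtain ⟨𝓜, hM, hMcard, -, hMcov⟩ := hL.join (l₁ := []) (m₁ := []) hl hm hlm hw hwc
      (fun v hv hv' => by
        obtain ⟨i, hi, hvi⟩ := Finset.mem_biUnion.1 (hcov hv')
        exact hwT v hv i hi hvi)
    refine ⟨𝓜, hM, by omega, ?_⟩
    have h1 := hcount 𝓛 hmiss
    have h2 : ((covered 𝓛).card : ℝ) ≤ (covered 𝓜).card := by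
      simp only [List.length_nil, add_zero] at hMcov
      exact_mod_cast hMcov
    linarith
  · obtain ⟨𝓛, hL, hcard, -, hmiss, -⟩ :=
      exists_isPathSystem_of_almost_complete I T hT hdisj id hself
    refine ⟨𝓛, hL, ?_, hcount 𝓛 hmiss⟩
    have hdisjN : (I : Set V).PairwiseDisjoint (closedNbhd G) := by
      intro a ha b hb hab
      refine Finset.disjoint_left.2 fun u hu hu' => hreach ?_
      refine ⟨a, ha, b, hb, hab, a, hself a ha, b, hself b hb, ?_⟩
      have key : ∀ c, u ∈ closedNbhd G c → G.Reachable c u := by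
        intro c hc
        rcases mem_closedNbhd.1 hc with rfl | hadj
        · exact SimpleGraph.Reachable.refl _
        · exact hadj.reachable
      exact (key a hu).trans (key b hu').symm
    have h1 : I.card * (d + 1) ≤ Fintype.card V := by
      rw [← Finset.sum_const_nat fun v _ => card_closedNbhd hd v, ← Finset.card_biUnion hdisjN]
      exact Finset.card_le_univ _
    rw [hcard]
    exact lt_of_mul_lt_mul_right (h1.trans_lt hn) (Nat.zero_le _)

end NearClique

section FewCherries

variable {V : Type*} {G : SimpleGraph V} [Fintype V] [DecidableEq V] [DecidableRel G.Adj]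

/-- The vertices of the closed neighbourhood of `v` that are adjacent to all but `t` of it. -/
def core (G : SimpleGraph V) [DecidableRel G.Adj] (t : ℕ) (v : V) : Finset V :=
  (closedNbhd G v).filter fun u => (closedNbhd G v \ closedNbhd G u).card ≤ t

theorem mem_core_self (t : ℕ) (v : V) : v ∈ core G t v :=
  Finset.mem_filter.2 ⟨mem_closedNbhd.2 (Or.inl rfl), by simp⟩

theorem core_subset (t : ℕ) (v : V) : core G t v ⊆ closedNbhd G v := Finset.filter_subset _ _

theorem card_core_sdiff_le {t : ℕ} {v u : V} (hu : u ∈ core G t v) :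
    (core G t v \ closedNbhd G u).card ≤ t :=
  (Finset.card_le_card (Finset.sdiff_subset_sdiff (core_subset t v) subset_rfl)).trans
    (Finset.mem_filter.1 hu).2

/-- Non-adjacent pairs in a neighbourhood are cherries centred at `v`, so few of them means that
the core is almost the whole closed neighbourhood. -/
theorem card_closedNbhd_sdiff_core_mul_le (t : ℕ) (v : V) :
    (closedNbhd G v \ core G t v).card * t ≤
      ((inducedCherries G Finset.univ).filter fun s => s.2.1 = v).card := by
  calc (closedNbhd G v \ core G t v).card * t
      ≤ ((closedNbhd G v \ core G t v).sigma fun u => closedNbhd G v \ closedNbhd G u).card := by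
        rw [Finset.card_sigma, ← smul_eq_mul]
        refine Finset.card_nsmul_le_sum _ _ _ fun u hu => ?_
        rw [Finset.mem_sdiff, core, Finset.mem_filter, not_and, not_le] at hu
        exact (hu.2 hu.1).le
    _ ≤ _ := by
        refine Finset.card_le_card_of_injOn (fun s => (s.1, v, s.2)) ?_ ?_
        · rintro ⟨u, w⟩ hs
          obtain ⟨hu, hw⟩ := Finset.mem_sigma.1 (Finset.mem_coe.1 hs)
          simp only [Finset.mem_sdiff] at hu hw
          have huv : u ≠ v := by
            rintro rfl
            exact hu.2 (mem_core_self t u)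
          have hvu : G.Adj v u := (mem_closedNbhd.1 hu.1).resolve_left huv
          have hwv : w ≠ v := by
            rintro rfl
            exact hw.2 (mem_closedNbhd.2 (Or.inr hvu.symm))
          have hvw : G.Adj v w := (mem_closedNbhd.1 hw.1).resolve_left hwv
          have hwu := hw.2
          rw [mem_closedNbhd, not_or] at hwu
          refine Finset.mem_coe.2 (Finset.mem_filter.2 ⟨Finset.mem_filter.2 ⟨Finset.mem_univ _,
            ?_, hvu.symm, hvw, Ne.symm hwu.1, hwu.2⟩, rfl⟩)
          simp
        · rintro ⟨u, w⟩ _ ⟨u', w'⟩ _ h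
          simp only [Prod.mk.injEq, true_and] at h
          obtain ⟨rfl, rfl⟩ := h
          rfl

/-- Common neighbours of `v` and a vertex outside its closed neighbourhood are centres of cherries
starting at `v`. -/
theorem card_filter_card_inter_mul_le (s : ℕ) (v : V) :
    (Finset.univ.filter fun w => w ∉ closedNbhd G v ∧
        s ≤ (closedNbhd G w ∩ closedNbhd G v).card).card * s ≤
      ((inducedCherries G Finset.univ).filter fun t => t.1 = v).card := by
  set E := Finset.univ.filter fun w => w ∉ closedNbhd G v ∧
    s ≤ (closedNbhd G w ∩ closedNbhd G v).card
  calc E.card * s ≤ (E.sigma fun w => closedNbhd G w ∩ closedNbhd G v).card := by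
        rw [Finset.card_sigma, ← smul_eq_mul]
        exact Finset.card_nsmul_le_sum _ _ _ fun w hw => (Finset.mem_filter.1 hw).2.2
    _ ≤ _ := by
        refine Finset.card_le_card_of_injOn (fun p => (v, p.2, p.1)) ?_ ?_
        · rintro ⟨w, y⟩ hp
          obtain ⟨hw, hy⟩ := Finset.mem_sigma.1 (Finset.mem_coe.1 hp)
          have hwv := (Finset.mem_filter.1 hw).2.1
          simp only [Finset.mem_inter] at hy
          have hyw : y ≠ w := by
            rintro rfl
            exact hwv hy.2
          have hyv : y ≠ v := by
            rintro rfl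
            exact hwv (mem_closedNbhd_comm.1 hy.1)
          have hwy : G.Adj w y := (mem_closedNbhd.1 hy.1).resolve_left hyw
          have hvy : G.Adj v y := (mem_closedNbhd.1 hy.2).resolve_left hyv
          rw [mem_closedNbhd, not_or] at hwv
          refine Finset.mem_coe.2 (Finset.mem_filter.2 ⟨Finset.mem_filter.2 ⟨Finset.mem_univ _,
            ?_, hvy, hwy.symm, Ne.symm hwv.1, hwv.2⟩, rfl⟩)
          simp
        · rintro ⟨u, w⟩ _ ⟨u', w'⟩ _ h
          simp only [Prod.mk.injEq, true_and] at h
          obtain ⟨rfl, rfl⟩ := h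
          rfl

theorem le_card_inter_of_not_disjoint_core {d t : ℕ} (hd : G.IsRegularOfDegree d) {v w : V}
    (h : ¬ Disjoint (core G t v) (core G t w)) :
    d + 1 ≤ (closedNbhd G v ∩ closedNbhd G w).card + 2 * t := by
  obtain ⟨u, hu, hu'⟩ := Finset.not_disjoint_iff.1 h
  have key : ∀ x, u ∈ core G t x → (closedNbhd G u \ closedNbhd G x).card ≤ t := by
    intro x hx
    have h1 := (Finset.mem_filter.1 hx).2
    have h2 : (closedNbhd G u \ closedNbhd G x).card = (closedNbhd G x \ closedNbhd G u).card :=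
      Finset.card_sdiff_comm (by rw [card_closedNbhd hd, card_closedNbhd hd])
    omega
  have h1 := key v hu
  have h2 := key w hu'
  have h3 : closedNbhd G u ⊆ (closedNbhd G v ∩ closedNbhd G w) ∪
      ((closedNbhd G u \ closedNbhd G v) ∪ (closedNbhd G u \ closedNbhd G w)) := by
    intro x hx
    simp only [Finset.mem_union, Finset.mem_inter, Finset.mem_sdiff]
    tauto
  have h4 := Finset.card_le_card h3
  rw [card_closedNbhd hd] at h4
  have h5 := Finset.card_union_le (closedNbhd G v ∩ closedNbhd G w)
    ((closedNbhd G u \ closedNbhd G v) ∪ (closedNbhd G u \ closedNbhd G w))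
  have h6 := Finset.card_union_le (closedNbhd G u \ closedNbhd G v)
    (closedNbhd G u \ closedNbhd G w)
  omega

theorem card_filter_lt_card_fibre_mul_le {α β : Type*} [Fintype β] [DecidableEq β]
    (S : Finset α) (f : α → β) (x : ℕ) :
    (Finset.univ.filter fun b => x < (S.filter fun a => f a = b).card).card * x ≤ S.card := by
  rw [Finset.card_eq_sum_card_fiberwise (f := f) (s := S) (t := Finset.univ)
    (fun _ _ => Finset.mem_coe.2 (Finset.mem_univ _)), ← smul_eq_mul]
  refine (Finset.card_nsmul_le_sum _ (fun b => (S.filter fun a => f a = b).card) x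
    fun b hb => (Finset.mem_filter.1 hb).2.le).trans ?_
  exact Finset.sum_le_sum_of_subset (Finset.filter_subset _ _)

/-- A regular graph with few induced cherries is almost a disjoint union of cliques: the cores of
a maximal family of typical vertices with disjoint cores contain almost everything.  Here `x` bounds
the number of cherries at a typical vertex. -/
theorem exists_cores {d t s x : ℕ} (hd : G.IsRegularOfDegree d) (hs : s + 2 * t ≤ d + 1) :
    ∃ I : Finset V, (∀ v ∈ I, ∀ w ∈ I, v ≠ w → Disjoint (core G t v) (core G t w)) ∧
      (∀ v ∈ I, (closedNbhd G v \ core G t v).card * t ≤ x) ∧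
      ∃ b e : ℕ, b * x ≤ 2 * (inducedCherries G Finset.univ).card ∧ e * s ≤ I.card * x ∧
        Fintype.card V ≤ (I.biUnion (core G t)).card +
          ∑ v ∈ I, (closedNbhd G v \ core G t v).card + e + b := by
  classical
  set X := inducedCherries G Finset.univ
  set good := Finset.univ.filter fun v => (X.filter fun t => t.1 = v).card ≤ x ∧
    (X.filter fun t => t.2.1 = v).card ≤ x with hgood
  set fam := good.powerset.filter fun I =>
    ∀ v ∈ I, ∀ w ∈ I, v ≠ w → Disjoint (core G t v) (core G t w) with hfam
  obtain ⟨I, hI, hmax⟩ := Finset.exists_max_image fam Finset.card ⟨∅, by simp [hfam]⟩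
  obtain ⟨hIgood, hIdisj⟩ := Finset.mem_filter.1 hI
  rw [Finset.mem_powerset] at hIgood
  have hcover : ∀ v ∈ good, ∃ w ∈ I, ¬ Disjoint (core G t v) (core G t w) := by
    intro v hv
    by_contra hno
    push Not at hno
    have hvI : v ∉ I := fun hvI =>
      Finset.disjoint_left.1 (hno v hvI) (mem_core_self t v) (mem_core_self t v)
    have h1 := hmax (insert v I) (Finset.mem_filter.2 ⟨Finset.mem_powerset.2
      (Finset.insert_subset hv hIgood), by
        intro a ha b hb hab
        rcases Finset.mem_insert.1 ha with rfl | ha' <;>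
          rcases Finset.mem_insert.1 hb with rfl | hb'
        · exact absurd rfl hab
        · exact hno b hb'
        · exact (hno a ha').symm
        · exact hIdisj a ha' b hb' hab⟩)
    rw [Finset.card_insert_of_notMem hvI] at h1
    omega
  set E : V → Finset V := fun v => Finset.univ.filter fun w => w ∉ closedNbhd G v ∧
    s ≤ (closedNbhd G w ∩ closedNbhd G v).card with hE
  set B₁ := Finset.univ.filter fun v => x < (X.filter fun t => t.1 = v).card
  set B₂ := Finset.univ.filter fun v => x < (X.filter fun t => t.2.1 = v).card
  refine ⟨I, hIdisj, ?_, (B₁ ∪ B₂).card, ∑ v ∈ I, (E v).card, ?_, ?_, ?_⟩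
  · intro v hv
    exact (card_closedNbhd_sdiff_core_mul_le t v).trans (Finset.mem_filter.1 (hIgood hv)).2.2
  · have h1 : B₁.card * x ≤ X.card := card_filter_lt_card_fibre_mul_le X (fun t => t.1) x
    have h2 : B₂.card * x ≤ X.card := card_filter_lt_card_fibre_mul_le X (fun t => t.2.1) x
    have h3 := Nat.mul_le_mul_right x (Finset.card_union_le B₁ B₂)
    rw [add_mul] at h3
    omega
  · rw [Finset.sum_mul, ← smul_eq_mul]
    refine Finset.sum_le_card_nsmul _ _ _ fun v hv => ?_
    exact (card_filter_card_inter_mul_le s v).trans (Finset.mem_filter.1 (hIgood hv)).2.1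
  · have hsub : (Finset.univ : Finset V) ⊆ ((I.biUnion (core G t) ∪
        I.biUnion fun v => closedNbhd G v \ core G t v) ∪ I.biUnion E) ∪ (B₁ ∪ B₂) := by
      intro v _
      simp only [Finset.mem_union, Finset.mem_biUnion]
      by_cases hv : v ∈ good
      · left
        obtain ⟨w, hw, hvw⟩ := hcover v hv
        have h1 := le_card_inter_of_not_disjoint_core hd hvw
        by_cases hvC : v ∈ closedNbhd G w
        · left
          by_cases hvT : v ∈ core G t w
          · exact Or.inl ⟨w, hw, hvT⟩
          · exact Or.inr ⟨w, hw, Finset.mem_sdiff.2 ⟨hvC, hvT⟩⟩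
        · exact Or.inr ⟨w, hw, Finset.mem_filter.2 ⟨Finset.mem_univ v, hvC, by omega⟩⟩
      · right
        rw [hgood, Finset.mem_filter, not_and, not_and_or, not_le, not_le] at hv
        rcases hv (Finset.mem_univ v) with h | h
        · exact Or.inl (Finset.mem_filter.2 ⟨Finset.mem_univ v, h⟩)
        · exact Or.inr (Finset.mem_filter.2 ⟨Finset.mem_univ v, h⟩)
    have h1 := Finset.card_le_card hsub
    rw [Finset.card_univ] at h1
    have h2 := Finset.card_union_le ((I.biUnion (core G t) ∪
        I.biUnion fun v => closedNbhd G v \ core G t v) ∪ I.biUnion E) (B₁ ∪ B₂)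
    have h3 := Finset.card_union_le (I.biUnion (core G t) ∪
        I.biUnion fun v => closedNbhd G v \ core G t v) (I.biUnion E)
    have h4 := Finset.card_union_le (I.biUnion (core G t))
        (I.biUnion fun v => closedNbhd G v \ core G t v)
    have h5 : (I.biUnion fun v => closedNbhd G v \ core G t v).card ≤ _ := Finset.card_biUnion_le
    have h6 : (I.biUnion E).card ≤ _ := Finset.card_biUnion_le
    omega

end FewCherries

/-- In the dense case with few induced cherries, `⌊n / (d + 1)⌋` paths cover almost everything. -/
theorem exists_isPathSystem_of_card_inducedCherries_le (J : ℕ) {ε : ℝ} (hε : 0 < ε) (hε1 : ε ≤ 1) :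
    ∃ τ : ℝ, 0 < τ ∧ ∃ d₀ : ℕ, ∀ d : ℕ, d₀ ≤ d →
      ∀ (V : Type*) [Fintype V] [DecidableEq V] (G : SimpleGraph V) [DecidableRel G.Adj],
        G.IsRegularOfDegree d → ∀ j ≤ J, Fintype.card V < j * (d + 1) →
          ((inducedCherries G Finset.univ).card : ℝ) ≤ τ * (d : ℝ) ^ 3 →
          ∃ 𝓛, IsPathSystem G 𝓛 ∧ 𝓛.card < j ∧
            (Fintype.card V : ℝ) ≤ (covered 𝓛).card + ε * d := by
  obtain ⟨θ, hθdef⟩ : ∃ θ : ℝ, θ = ε / (8 * (J + 1)) := ⟨_, rfl⟩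
  have hJ0 : (0 : ℝ) ≤ J := Nat.cast_nonneg J
  have hθ : 0 < θ := by rw [hθdef]; positivity
  have hθJ : θ * (J + 1) = ε / 8 := by rw [hθdef]; field_simp
  have hθ8 : θ ≤ 1 / 8 := by nlinarith
  refine ⟨θ ^ 2 / 4 * (ε / 8), by positivity, ⌈2 / θ + 4 / θ ^ 2⌉₊ + 1, ?_⟩
  intro d hd₀ V _ _ G _ hd j hj hn hX
  have hd1 : 2 / θ + 4 / θ ^ 2 ≤ d := by
    have h1 := Nat.le_ceil (2 / θ + 4 / θ ^ 2)
    have h2 : ((⌈2 / θ + 4 / θ ^ 2⌉₊ : ℕ) : ℝ) ≤ d := by exact_mod_cast (by omega)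
    linarith
  have hdone : (1 : ℝ) ≤ d := by exact_mod_cast (by omega : 1 ≤ d)
  have hdθ : 2 ≤ θ * d := by
    have : 2 / θ ≤ d := by
      have : 0 ≤ 4 / θ ^ 2 := by positivity
      linarith
    rw [div_le_iff₀ hθ] at this
    linarith
  have hdη : 1 ≤ θ ^ 2 / 4 * (d : ℝ) ^ 2 := by
    have h1 : 4 / θ ^ 2 ≤ d := by
      have : 0 ≤ 2 / θ := by positivity
      linarith
    rw [div_le_iff₀ (by positivity)] at h1
    have h2 : (d : ℝ) * θ ^ 2 ≤ (d : ℝ) ^ 2 * θ ^ 2 := by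
      gcongr
      exact le_self_pow₀ hdone two_ne_zero
    linarith
  obtain ⟨t, ht⟩ : ∃ t, t = ⌊θ * d⌋₊ := ⟨_, rfl⟩
  obtain ⟨x, hx⟩ : ∃ x, x = ⌈θ ^ 2 / 4 * (d : ℝ) ^ 2⌉₊ := ⟨_, rfl⟩
  have htle : (t : ℝ) ≤ θ * d := by rw [ht]; exact Nat.floor_le (by positivity)
  have htge : θ * d / 2 ≤ t := by
    have := Nat.lt_floor_add_one (θ * d)
    rw [← ht] at this
    linarith
  have hxge : θ ^ 2 / 4 * (d : ℝ) ^ 2 ≤ x := by rw [hx]; exact Nat.le_ceil _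
  have hxle : (x : ℝ) ≤ 2 * (θ ^ 2 / 4 * (d : ℝ) ^ 2) := by
    have := Nat.ceil_lt_add_one (a := θ ^ 2 / 4 * (d : ℝ) ^ 2) (by positivity)
    rw [← hx] at this
    linarith
  have ht8 : (t : ℝ) ≤ d / 8 := by nlinarith
  have ht8' : 8 * t ≤ d := by
    have : (8 : ℝ) * t ≤ d := by linarith
    exact_mod_cast this
  obtain ⟨s, hs⟩ : ∃ s, s = d + 1 - 2 * t := ⟨_, rfl⟩
  have hsge : (d : ℝ) / 2 ≤ s := by
    have : d ≤ 2 * s := by omega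
    have : (d : ℝ) ≤ 2 * s := by exact_mod_cast this
    linarith
  obtain ⟨I, hIdisj, hIcore, b, e, hb, he, hcov⟩ := exists_cores (x := x) hd
    (show s + 2 * t ≤ d + 1 by omega)
  have hcore : ∀ v ∈ I, ((closedNbhd G v \ core G t v).card : ℝ) ≤ θ * d := by
    intro v hv
    have h1 : ((closedNbhd G v \ core G t v).card : ℝ) * t ≤ x := by exact_mod_cast hIcore v hv
    have h2 : ((closedNbhd G v \ core G t v).card : ℝ) * (θ * d / 2) ≤ θ * d * (θ * d / 2) := by
      calc ((closedNbhd G v \ core G t v).card : ℝ) * (θ * d / 2)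
          ≤ ((closedNbhd G v \ core G t v).card : ℝ) * t := by gcongr
        _ ≤ 2 * (θ ^ 2 / 4 * (d : ℝ) ^ 2) := h1.trans hxle
        _ = θ * d * (θ * d / 2) := by ring
    exact le_of_mul_le_mul_right h2 (by positivity)
  have hIj : I.card ≤ j := by
    by_contra hcon
    have h1 : (I.biUnion (core G t)).card = ∑ v ∈ I, (core G t v).card :=
      Finset.card_biUnion fun v hv w hw hvw => hIdisj v hv w hw hvw
    have h2 : ∀ v ∈ I, (d : ℝ) + 1 - θ * d ≤ ((core G t v).card : ℝ) := by
      intro v hv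
      have h3 : ((closedNbhd G v \ core G t v).card : ℝ) + (core G t v).card = d + 1 := by
        have := Finset.card_sdiff_add_card_eq_card (core_subset (G := G) t v)
        rw [card_closedNbhd hd] at this
        exact_mod_cast this
      have := hcore v hv
      linarith
    have h4 : (I.card : ℝ) * (d + 1 - θ * d) ≤ Fintype.card V := by
      calc (I.card : ℝ) * (d + 1 - θ * d) ≤ ∑ v ∈ I, ((core G t v).card : ℝ) := by
            rw [← nsmul_eq_mul]; exact Finset.card_nsmul_le_sum I _ _ h2
        _ = ((I.biUnion (core G t)).card : ℝ) := by rw [h1, Nat.cast_sum]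
        _ ≤ Fintype.card V := by exact_mod_cast Finset.card_le_univ _
    have h5 : (j : ℝ) + 1 ≤ I.card := by exact_mod_cast (by omega : j + 1 ≤ I.card)
    have h6 : (Fintype.card V : ℝ) < j * (d + 1) := by exact_mod_cast hn
    have hjJ : (j : ℝ) ≤ J := by exact_mod_cast hj
    have hθj : θ * (j + 1) ≤ 1 := by
      have : θ * (j + 1) ≤ θ * (J + 1) := by gcongr
      linarith
    have hpos : 0 ≤ (d : ℝ) + 1 - θ * d := by nlinarith
    have h7 : ((j : ℝ) + 1) * (d + 1 - θ * d) ≤ I.card * (d + 1 - θ * d) := by gcongr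
    have h8 : θ * (j + 1) * d ≤ 1 * d := by gcongr
    linarith
  obtain ⟨𝓛, hL, hcard, hlen⟩ := exists_isPathSystem_card_lt hd hn I (core G t) (t := t)
    (fun i _ u hu => by exact_mod_cast card_core_sdiff_le hu) hIdisj
    (fun i _ => mem_core_self t i) hIj
  refine ⟨𝓛, hL, hcard, ?_⟩
  have hIJ : (I.card : ℝ) ≤ J := by exact_mod_cast hIj.trans hj
  have hθd : 0 ≤ θ * d := by positivity
  have k1 : ∑ v ∈ I, ((closedNbhd G v \ core G t v).card : ℝ) ≤ J * (θ * d) := by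
    refine (Finset.sum_le_card_nsmul I _ _ hcore).trans ?_
    rw [nsmul_eq_mul]
    gcongr
  have k2 : (e : ℝ) ≤ J * (θ * d) := by
    have h1 : (e : ℝ) * s ≤ I.card * x := by exact_mod_cast he
    have h2 : (e : ℝ) * (d / 2) ≤ J * (θ * d) * (d / 2) := by
      calc (e : ℝ) * (d / 2) ≤ e * s := by gcongr
        _ ≤ I.card * x := h1
        _ ≤ J * (2 * (θ ^ 2 / 4 * (d : ℝ) ^ 2)) := by gcongr
        _ = J * (θ * θ * d) * (d / 2) := by ring
        _ ≤ J * (1 * θ * d) * (d / 2) := by gcongr; linarith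
        _ = J * (θ * d) * (d / 2) := by ring
    exact le_of_mul_le_mul_right h2 (by positivity)
  have k3 : (b : ℝ) ≤ ε / 4 * d := by
    have h1 : (b : ℝ) * x ≤ 2 * (inducedCherries G Finset.univ).card := by exact_mod_cast hb
    have h2 : (b : ℝ) * (θ ^ 2 / 4 * (d : ℝ) ^ 2) ≤ ε / 4 * d * (θ ^ 2 / 4 * (d : ℝ) ^ 2) := by
      calc (b : ℝ) * (θ ^ 2 / 4 * (d : ℝ) ^ 2) ≤ b * x := by gcongr
        _ ≤ 2 * (θ ^ 2 / 4 * (ε / 8) * (d : ℝ) ^ 3) := by linarith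
        _ = ε / 4 * d * (θ ^ 2 / 4 * (d : ℝ) ^ 2) := by ring
    exact le_of_mul_le_mul_right h2 (by positivity)
  have k4 : (I.card : ℝ) * t ≤ J * (θ * d) := by gcongr
  have k5 : (J : ℝ) * (θ * d) ≤ ε / 8 * d := by
    calc (J : ℝ) * (θ * d) ≤ (J + 1) * (θ * d) := by gcongr; linarith
      _ = θ * (J + 1) * d := by ring
      _ = ε / 8 * d := by rw [hθJ]
  have k6 : (Fintype.card V : ℝ) ≤ (I.biUnion (core G t)).card +
      ∑ v ∈ I, ((closedNbhd G v \ core G t v).card : ℝ) + e + b := by exact_mod_cast hcov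
  have k7 : 0 ≤ ε * d := by positivity
  linarith

/-! ### The sparse and the dense case -/

/-- Some set of at most three groups contains a constant proportion of the induced cherries. -/
theorem exists_groups_card_inducedCherries_le {V : Type*} [Fintype V] [DecidableEq V]
    (G : SimpleGraph V) [DecidableRel G.Adj] {q : ℕ} (hq : 0 < q) (g : V → Fin q) :
    ∃ F : Finset (Fin q), F.card ≤ 3 ∧ (inducedCherries G Finset.univ).card ≤
      (inducedCherries G (Finset.univ.filter fun v => g v ∈ F)).card * q ^ 3 := by
  by_contra hcon
  push Not at hcon
  have : NeZero q := ⟨hq.ne'⟩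
  have h1 := Finset.card_eq_sum_card_fiberwise (s := inducedCherries G Finset.univ)
    (f := fun t => (g t.1, g t.2.1, g t.2.2)) (t := Finset.univ)
    (fun _ _ => Finset.mem_coe.2 (Finset.mem_univ _))
  have h2 : ∀ c ∈ (Finset.univ : Finset (Fin q × Fin q × Fin q)),
      ((inducedCherries G Finset.univ).filter fun t => (g t.1, g t.2.1, g t.2.2) = c).card * q ^ 3 <
        (inducedCherries G Finset.univ).card := by
    rintro ⟨c₁, c₂, c₃⟩ -
    refine lt_of_le_of_lt ?_ (hcon {c₁, c₂, c₃} Finset.card_le_three)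
    refine Nat.mul_le_mul_right _ (Finset.card_le_card fun t ht => ?_)
    obtain ⟨ht, htc⟩ := Finset.mem_filter.1 ht
    obtain ⟨-, -, ht⟩ := Finset.mem_filter.1 ht
    simp only [Prod.mk.injEq] at htc
    refine Finset.mem_filter.2 ⟨Finset.mem_univ t, ?_, ht⟩
    simp [htc.1, htc.2.1, htc.2.2]
  have h3 := Finset.sum_lt_sum_of_nonempty Finset.univ_nonempty h2
  rw [← Finset.sum_mul, ← h1, Finset.sum_const, Finset.card_univ, smul_eq_mul] at h3
  simp only [Fintype.card_prod, Fintype.card_fin] at h3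
  have : q * (q * q) = q ^ 3 := by ring
  rw [this, mul_comm] at h3
  exact lt_irrefl _ h3

/-- When `n / d` is large, the shortest paths can be dropped. -/
theorem IsPathSystem.exists_card_le_div {V : Type*} [Fintype V] [DecidableEq V]
    {G : SimpleGraph V} {𝓛 : Finset (List V)} (h : IsPathSystem G 𝓛) {d : ℕ} {ε δ : ℝ} (hδ : 0 < δ)
    (hε1 : ε ≤ 1) (hδε : δ ≤ ε / 22) (hd : 8 / ε ≤ d)
    (hn : 8 / ε * d ≤ Fintype.card V) (hcard : (𝓛.card : ℝ) ≤ (1 + δ) / d * Fintype.card V)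
    (hcov : (1 - δ) * Fintype.card V ≤ ((covered 𝓛).card : ℝ)) :
    ∃ 𝓜, IsPathSystem G 𝓜 ∧ 𝓜.card ≤ Fintype.card V / (d + 1) ∧
      (1 - ε) * Fintype.card V ≤ ((covered 𝓜).card : ℝ) := by
  have hε : 0 < ε := by linarith
  have hdr : (0 : ℝ) < d := lt_of_lt_of_le (by positivity) hd
  by_cases hle : 𝓛.card ≤ Fintype.card V / (d + 1)
  · refine ⟨𝓛, h, hle, le_trans ?_ hcov⟩
    gcongr
    linarith
  obtain ⟨𝓜, hM, hMcard, hMcov⟩ := h.exists_card_eq (Fintype.card V / (d + 1)) (by omega)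
  refine ⟨𝓜, hM, hMcard.le, ?_⟩
  obtain ⟨k, hk⟩ : ∃ k, k = Fintype.card V / (d + 1) := ⟨_, rfl⟩
  have hkn : Fintype.card V < (k + 1) * (d + 1) := by
    rw [hk, mul_comm]; exact Nat.lt_mul_div_succ _ (Nat.succ_pos d)
  rw [← hk] at hMcov
  obtain ⟨n, hn'⟩ : ∃ n : ℝ, n = Fintype.card V := ⟨_, rfl⟩
  have hkn' : n < (k + 1) * (d + 1) := by rw [hn']; exact_mod_cast hkn
  rw [← hn'] at hn hcard hcov ⊢
  have hn0 : 0 < n := lt_of_lt_of_le (by positivity) hn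
  have hMcov' : ((covered 𝓛).card : ℝ) * k ≤ (covered 𝓜).card * 𝓛.card := by exact_mod_cast hMcov
  -- `k d ≥ n - d - k ≥ (1 - ε / 4) n`
  have h1 : (d : ℝ) ≤ ε / 8 * n := by
    have := mul_le_mul_of_nonneg_left hn (by positivity : 0 ≤ ε / 8)
    have e : ε / 8 * (8 / ε * d) = d := by field_simp
    linarith
  have h2 : (k : ℝ) * d ≤ n := by
    have : k * (d + 1) ≤ Fintype.card V := by rw [hk]; exact Nat.div_mul_le_self _ _
    have : (k : ℝ) * (d + 1) ≤ n := by rw [hn']; exact_mod_cast this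
    nlinarith
  have h3 : (1 : ℝ) + k ≤ ε / 8 * n + 1 := by
    rw [div_le_iff₀ hε] at hd
    have : (k : ℝ) * 8 ≤ k * (d * ε) := by gcongr
    have : (k : ℝ) * d * ε ≤ n * ε := by gcongr
    linarith
  have h4 : (1 - ε / 4) * n - 1 ≤ k * d := by linarith
  have h5 : ((covered 𝓜).card : ℝ) * 𝓛.card ≤ (covered 𝓜).card * ((1 + δ) / d * n) := by gcongr
  have h6 : (1 - δ) * n * k ≤ (covered 𝓜).card * ((1 + δ) / d * n) :=
    le_trans (by gcongr) (hMcov'.trans h5)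
  have h7 : (1 - δ) * (k * d) * n ≤ (covered 𝓜).card * (1 + δ) * n := by
    calc (1 - δ) * (k * d) * n = (1 - δ) * n * k * d := by ring
      _ ≤ (covered 𝓜).card * ((1 + δ) / d * n) * d := by gcongr
      _ = _ := by field_simp
  have h8 : (1 - δ) * (k * d) ≤ (covered 𝓜).card * (1 + δ) := le_of_mul_le_mul_right h7 hn0
  have h9 : (1 - δ) * ((1 - ε / 4) * n - 1) ≤ (covered 𝓜).card * (1 + δ) :=
    le_trans (mul_le_mul_of_nonneg_left h4 (by linarith)) h8
  have h10 : 64 ≤ ε * n := by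
    rw [div_le_iff₀ hε] at hd
    have : 8 / ε * d * ε ≤ n * ε := by gcongr
    have e : 8 / ε * d * ε = 8 * d := by field_simp
    nlinarith
  by_contra hcon
  push Not at hcon
  have h11 : ((covered 𝓜).card : ℝ) * (1 + δ) ≤ (1 - ε) * n * (1 + δ) := by gcongr
  have h12 : (1 - δ) * ((1 - ε / 4) * n - 1) ≥ (1 - ε / 22) * ((1 - ε / 4) * n - 1) := by
    have : 0 ≤ (1 - ε / 4) * n - 1 := by nlinarith
    gcongr
  have h13 : (1 - ε) * n * (1 + δ) ≤ (1 - ε) * n * (1 + ε / 22) := by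
    have : 0 ≤ (1 - ε) * n := mul_nonneg (by linarith) hn0.le
    gcongr
  have h14 : (1 - ε / 22) * ((1 - ε / 4) * n - 1) ≤ (1 - ε) * n * (1 + ε / 22) := by linarith
  nlinarith [mul_nonneg hε.le hn0.le, mul_nonneg (mul_nonneg hε.le hε.le) hn0.le]

/-- The main result for path systems.  In the dense case, where `j = ⌊n / (d + 1)⌋ + 1` is bounded,
the merged system has at most `j` paths, so that a single further link is enough. -/
theorem exists_isPathSystem_of_regular {ε : ℝ} (hε : 0 < ε) (hε1 : ε ≤ 1) :
    ∃ d₀ : ℕ, ∀ d : ℕ, d₀ ≤ d →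
      ∀ (V : Type*) [Fintype V] [DecidableEq V] (G : SimpleGraph V) [DecidableRel G.Adj],
        G.IsRegularOfDegree d → ∃ 𝓛, IsPathSystem G 𝓛 ∧ 𝓛.card ≤ Fintype.card V / (d + 1) ∧
          (1 - ε) * Fintype.card V ≤ ((covered 𝓛).card : ℝ) := by
  obtain ⟨δ, hδdef⟩ : ∃ δ : ℝ, δ = ε / 22 := ⟨_, rfl⟩
  have hδ : 0 < δ := by rw [hδdef]; positivity
  obtain ⟨q, hq0, hq⟩ := exists_groups_and_isPathSystem hδ (by linarith)
  obtain ⟨J, hJ⟩ : ∃ J : ℕ, J = ⌈8 / ε⌉₊ + 1 := ⟨_, rfl⟩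
  have hJge : 8 / ε + 1 ≤ J := by
    rw [hJ]; push_cast; linarith [Nat.le_ceil (8 / ε)]
  have hJle : (J : ℝ) ≤ 10 / ε := by
    have h1 := Nat.ceil_lt_add_one (a := 8 / ε) (by positivity)
    have h2 : 1 ≤ 1 / ε := by rw [le_div_iff₀ hε]; linarith
    have h3 : 10 / ε = 8 / ε + 2 * (1 / ε) := by ring
    rw [hJ]; push_cast; linarith
  have hJ0 : (0 : ℝ) < J := lt_of_lt_of_le (by positivity) hJge
  obtain ⟨τ, hτ, d₁, hfew⟩ := exists_isPathSystem_of_card_inducedCherries_le J hε hε1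
  have hqr : (1 : ℝ) ≤ q := by exact_mod_cast hq0
  -- the precision with which the reserve samples the graph, chosen after the number of groups
  obtain ⟨δ', hδ'def⟩ : ∃ δ' : ℝ,
      δ' = min 1 (min (ε / (16 * J)) (τ / (26 * J ^ 2 * q ^ 3))) := ⟨_, rfl⟩
  have hδ' : 0 < δ' := by rw [hδ'def]; positivity
  have hδ'1 : δ' ≤ 1 := by rw [hδ'def]; exact min_le_left _ _
  have hδ'2 : 16 * (δ' * J) ≤ ε := by
    have : δ' ≤ ε / (16 * J) := by
      rw [hδ'def]; exact (min_le_right _ _).trans (min_le_left _ _)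
    rw [le_div_iff₀ (by positivity)] at this
    linarith
  have hδ'3 : 26 * J ^ 2 * δ' * q ^ 3 ≤ τ := by
    have : δ' ≤ τ / (26 * J ^ 2 * q ^ 3) := by
      rw [hδ'def]; exact (min_le_right _ _).trans (min_le_right _ _)
    rw [le_div_iff₀ (by positivity)] at this
    linarith
  obtain ⟨d₂, hgroups⟩ := hq δ' hδ'
  refine ⟨d₁ + d₂ + ⌈4 * (J : ℝ) + 16 / ε + 2 / δ'⌉₊, fun d hd₀ V _ _ G _ hd => ?_⟩
  have hdbig : 4 * J + 16 / ε + 2 / δ' ≤ d := by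
    have h1 := Nat.le_ceil (4 * (J : ℝ) + 16 / ε + 2 / δ')
    have h2 : ((⌈4 * (J : ℝ) + 16 / ε + 2 / δ'⌉₊ : ℕ) : ℝ) ≤ d := Nat.cast_le.2 (by omega)
    linarith
  have hε8 : 0 < 8 / ε := by positivity
  have hδ'p : 0 < 2 / δ' := by positivity
  have hdε : 8 / ε ≤ d := by
    have : 16 / ε = 2 * (8 / ε) := by ring
    linarith
  have hdJ : 4 * (J : ℝ) ≤ d := by
    have : 0 < 16 / ε := by positivity
    linarith
  have hdε' : 16 ≤ ε * d := by
    have : 16 / ε ≤ d := by linarith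
    rw [div_le_iff₀ hε] at this
    linarith
  have hdδ' : 2 ≤ δ' * d := by
    have : 2 / δ' ≤ d := by
      have : 0 < 16 / ε := by positivity
      linarith
    rw [div_le_iff₀ hδ'] at this
    linarith
  have hdr : (0 : ℝ) < d := by linarith
  obtain ⟨g, B, hB, hdeg, hsize, hpaths⟩ := hgroups d (by omega) V G hd
  obtain ⟨n, hn⟩ : ∃ n : ℝ, n = Fintype.card V := ⟨_, rfl⟩
  by_cases hsparse : 8 / ε * d ≤ n
  · obtain ⟨𝓛, hL, -, hcard, hcov⟩ := hpaths ∅ (by simp)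
    exact hL.exists_card_le_div hδ hε1 hδdef.le hdε (hn ▸ hsparse) hcard hcov
  push Not at hsparse
  obtain ⟨j, hj⟩ : ∃ j, j = Fintype.card V / (d + 1) + 1 := ⟨_, rfl⟩
  have hnj : Fintype.card V < j * (d + 1) := by
    rw [hj, mul_comm]; exact Nat.lt_mul_div_succ _ (Nat.succ_pos d)
  have hjJ : j ≤ J := by
    have h1 : Fintype.card V / (d + 1) * (d + 1) ≤ Fintype.card V := Nat.div_mul_le_self _ _
    have h2 : ((Fintype.card V / (d + 1) : ℕ) : ℝ) * (d + 1) ≤ n := by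
      rw [hn]; exact_mod_cast h1
    have h3 : ((Fintype.card V / (d + 1) : ℕ) : ℝ) ≤ 8 / ε := by
      have : ((Fintype.card V / (d + 1) : ℕ) : ℝ) * d ≤ 8 / ε * d := by nlinarith
      exact le_of_mul_le_mul_right this hdr
    have h4 : (j : ℝ) ≤ J := by rw [hj]; push_cast; linarith
    exact_mod_cast h4
  have hnd : 0 < Fintype.card V → (d : ℝ) ≤ n := by
    intro hpos
    obtain ⟨v⟩ := Fintype.card_pos_iff.1 hpos
    have := G.degree_lt_card_verts v
    rw [hd v] at this
    rw [hn]; exact_mod_cast this.le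
  rcases Nat.eq_zero_or_pos (Fintype.card V) with h0 | hpos
  · exact ⟨∅, isPathSystem_empty G, by simp, by simp [h0]⟩
  have hdn := hnd hpos
  by_cases hX : ((inducedCherries G Finset.univ).card : ℝ) ≤ τ * (d : ℝ) ^ 3
  · obtain ⟨𝓛, hL, hcard, hcov⟩ := hfew d (by omega) V G hd j hjJ hnj hX
    refine ⟨𝓛, hL, by omega, ?_⟩
    rw [← hn] at hcov ⊢
    have : ε * d ≤ ε * n := by gcongr
    linarith
  push Not at hX
  obtain ⟨F, hF, hXF⟩ := exists_groups_card_inducedCherries_le G hq0 g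
  obtain ⟨𝓛, hL, hLF, hcard, hcov⟩ := hpaths F hF
  rw [← hn] at hcard hcov hB ⊢
  have hsizeF := hsize F
  rw [← hn] at hsizeF
  have hjr : n < j * (d + 1) := by rw [hn]; exact_mod_cast hnj
  have hjJr : (j : ℝ) ≤ J := by exact_mod_cast hjJ
  have hnJ : n ≤ J * d := by
    have : 8 / ε * d ≤ J * d := by gcongr; linarith
    linarith
  have hcardj : 𝓛.card ≤ j := by
    have h1 : (𝓛.card : ℝ) < j + 1 := by
      have hδJ : δ * J ≤ 10 / 22 := by
        calc δ * J ≤ ε / 22 * (10 / ε) := by rw [hδdef]; gcongr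
          _ = 10 / 22 := by field_simp
      have h2 : (𝓛.card : ℝ) * d ≤ (1 + δ) * n := by
        calc (𝓛.card : ℝ) * d ≤ (1 + δ) / d * n * d := by gcongr
          _ = (1 + δ) * n := by field_simp
      have h3 : (1 + δ) * n ≤ (1 + δ) * (j * (d + 1)) := by gcongr
      have h4 : (1 + δ) * (j * (d + 1)) = j * d + δ * j * d + (1 + δ) * j := by ring
      have h5 : δ * j * d ≤ 10 / 22 * d := by
        have : δ * (j : ℝ) ≤ δ * J := by gcongr
        gcongr
        linarith
      have h6 : (1 + δ) * (j : ℝ) ≤ (1 + 1 / 22) * J := by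
        gcongr
        rw [hδdef]; linarith
      have h7 : (𝓛.card : ℝ) * d < (j + 1) * d := by
        have : ((j : ℝ) + 1) * d = j * d + d := by ring
        linarith
      exact lt_of_mul_lt_mul_right h7 hdr.le
    have h2 : 𝓛.card < j + 1 := by exact_mod_cast h1
    omega
  have hεn : 0 ≤ ε * n := by rw [hn]; positivity
  rcases Nat.lt_or_ge 𝓛.card j with hlt | hge
  · refine ⟨𝓛, hL, by omega, le_trans ?_ hcov⟩
    rw [hδdef]
    linarith
  have hLj : 𝓛.card = j := le_antisymm hcardj hge
  have hLne : 𝓛.Nonempty := Finset.card_pos.1 (by rw [hLj, hj]; exact Nat.succ_pos _)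
  set R := Finset.univ.filter fun v => g v ∈ F with hR
  have hs : ⌈ε / 8 * d⌉₊ ≤ ε / 8 * d + 1 := (Nat.ceil_lt_add_one (by positivity)).le
  have hBd : (B.card : ℝ) ≤ δ' * J * d := by
    calc (B.card : ℝ) ≤ δ' * n := hB
      _ ≤ δ' * (J * d) := by gcongr
      _ = δ' * J * d := by ring
  have hF3 : (F.card : ℝ) ≤ 3 := by exact_mod_cast hF
  have hRcard : (R.card : ℝ) ≤
      𝓛.card * (F.card * (d / q : ℝ) * (1 - δ')) + 12 * J * (δ' * d) := by
    rw [hLj]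
    have h1 : F.card * (n / q : ℝ) * (1 + δ') ≤ F.card * (j * (d + 1) / q : ℝ) * (1 + δ') := by
      gcongr
    have h2 : F.card * (j * (d + 1) / q : ℝ) * (1 + δ') =
        j * (F.card * (d / q : ℝ) * (1 - δ')) +
          F.card * j * (1 + δ' + 2 * (δ' * d)) * (1 / q) := by ring
    have h3 : F.card * j * (1 + δ' + 2 * (δ' * d)) * (1 / q : ℝ) ≤
        3 * J * (4 * (δ' * d)) * 1 := by
      gcongr
      · linarith
      · rw [div_le_one (by linarith)]; exact hqr
    linarith
  rcases hL.exists_link_or_card_inducedCherries_le (R := R) (B := B) (s := ⌈ε / 8 * d⌉₊)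
    (fun v => (hd v).le) hLne
    (by
      have : (B.card : ℝ) < ε / 8 * d := by
        have : δ' * J * d ≤ ε / 16 * d := by gcongr; linarith
        have : 0 < ε * d := by positivity
        linarith
      exact_mod_cast lt_of_lt_of_le this (Nat.le_ceil _))
    (by positivity) (fun v hv hvR => hLF v hv (Finset.mem_filter.1 hvR).2) (hdeg F) hRcard with
    ⟨𝓜, hM, hMcard, hMcov⟩ | hfewR
  · refine ⟨𝓜, hM, by omega, ?_⟩
    have h1 : ((covered 𝓛).card : ℝ) ≤ (covered 𝓜).card + 2 * (⌈ε / 8 * d⌉₊ : ℕ) := by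
      exact_mod_cast hMcov
    have h2 : ε * d ≤ ε * n := by gcongr
    rw [hδdef] at hcov
    linarith
  · -- then `G` has too few induced cherries altogether
    exfalso
    have hRn : (R.card : ℝ) ≤ J * d := by
      refine le_trans ?_ hnJ
      rw [hn]; exact_mod_cast Finset.card_le_univ R
    have hJ1 : (1 : ℝ) ≤ J := by linarith
    have h1 : ((inducedCherries G R).card : ℝ) ≤ 25 * J ^ 2 * δ' * (d : ℝ) ^ 3 := by
      calc ((inducedCherries G R).card : ℝ)
          ≤ R.card * (d * (12 * J * (δ' * d))) + (12 * J * (δ' * d) + B.card) * (d * d) := hfewR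
        _ ≤ J * d * (d * (12 * J * (δ' * d))) + (12 * J * (δ' * d) + δ' * J * d) * (d * d) := by
          gcongr
        _ = (12 * J ^ 2 + 13 * J * 1) * δ' * (d : ℝ) ^ 3 := by ring
        _ ≤ (12 * J ^ 2 + 13 * J * J) * δ' * (d : ℝ) ^ 3 := by gcongr
        _ = 25 * J ^ 2 * δ' * (d : ℝ) ^ 3 := by ring
    have h2 : ((inducedCherries G Finset.univ).card : ℝ) ≤ (inducedCherries G R).card * q ^ 3 := by
      exact_mod_cast hXF
    have h3 : ((inducedCherries G R).card : ℝ) * q ^ 3 ≤ 26 * J ^ 2 * δ' * q ^ 3 * (d : ℝ) ^ 3 := by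
      calc ((inducedCherries G R).card : ℝ) * q ^ 3
          ≤ 25 * J ^ 2 * δ' * (d : ℝ) ^ 3 * q ^ 3 := by gcongr
        _ ≤ 26 * J ^ 2 * δ' * (d : ℝ) ^ 3 * q ^ 3 := by gcongr; norm_num
        _ = _ := by ring
    have h4 : 26 * J ^ 2 * δ' * q ^ 3 * (d : ℝ) ^ 3 ≤ τ * (d : ℝ) ^ 3 := by gcongr
    linarith

theorem theorem2 (ε : ℝ) (hε : 0 < ε) :
    ∃ d₀ : ℕ, ∀ d : ℕ, d₀ ≤ d →
      ∀ (V : Type*) [Fintype V] (G : SimpleGraph V) [DecidableRel G.Adj] (n : ℕ),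
        Fintype.card V = n → G.IsRegularOfDegree d →
          ∃ (S : Set V) (k : ℕ) (a b : Fin k → V) (p : ∀ i, G.Walk (a i) (b i)),
            IsPathPartition G S p ∧
            (Sᶜ.ncard : ℝ) ≤ ε * (n : ℝ) ∧
            (k : ℝ) ≤ (n : ℝ) / ((d : ℝ) + 1) := by
  obtain ⟨d₀, h⟩ := exists_isPathSystem_of_regular (ε := min ε 1) (by positivity) (min_le_right _ _)
  refine ⟨d₀, fun d hd₀ V _ G _ n hn hd => ?_⟩
  classical
  obtain ⟨𝓛, hL, hcard, hcov⟩ := h d hd₀ V G hd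
  obtain ⟨a, b, p, hp⟩ := hL.exists_isPathPartition
  refine ⟨covered 𝓛, 𝓛.card, a, b, p, hp, ?_, ?_⟩
  · rw [← Finset.coe_compl, Set.ncard_coe_finset]
    have h1 : ((covered 𝓛).card : ℝ) + (covered 𝓛)ᶜ.card = n := by
      rw [← hn]; exact_mod_cast Finset.card_add_card_compl (covered 𝓛)
    rw [hn] at hcov
    have h2 : min ε 1 * n ≤ ε * n := by
      gcongr
      exact min_le_left _ _
    linarith
  · rw [le_div_iff₀ (by positivity), ← hn]
    exact_mod_cast (Nat.mul_le_mul_right (d + 1) hcard).trans (Nat.div_mul_le_self _ _)
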